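/- Let $k\ge 2$, $n\ge 1$ and $s_1,\dots,s_k\ge 1$ be integers. An input is a tuple $(S_1,\dots,S_k)$ of subsets of $[n]$ with $|S_i|=s_i$, where $S_i$ is known only to player $i$. In the $[s_1,\dots,s_k]$-size unique set-disjointness problem the players are promised that either the sets $S_i$ are pairwise disjoint, or there is an $x\in S_1\cap\dots\cap S_k$ such that the sets $S_i\setminus\{x\}$ are pairwise disjoint; they must decide which case holds. Protocols are blackboard protocols: the bits are written one after another on a common blackboard, the next speaker is determined by what has been written so far, each bit depends on the speaker's input and on what has been written so far, and the output is determined by the transcript. A randomized protocol is a probability distribution over deterministic ones (public coins; private coins are covered). A protocol is $[c_1,\dots,c_k]$-bounded ($c_i$ non-negative integers) if in every transcript player $i$ sends at most $c_i$ bits. **(Theorem 1.4, randomized protocols, worst-case inputs.)** For every $\delta<1/2$ there is a constant $C_\delta>0$, depending only on $\delta$, such that for all $k,n,s,c$ as above with $\sum_i s_i\le n/2$: if some randomized $[c_1,\dots,c_k]$-bounded $k$-party protocol solves the $[s_1,\dots,s_k]$-size unique set-disjointness problem with probability of error at most $\delta$ on every input satisfying the promise, then $$\sum_{i=1}^k \frac{c_i}{s_i}\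 \ge\ C_\delta .$$ **(Theorem 2.9, deterministic protocols, uniform inputs.)** Let $D_{\mathfrak s}$ be the even mixture of the uniform distribution on the pairwise disjoint inputs of sizes $s_1,\dots,s_k$ and the uniform distribution on the unique-intersection inputs of sizes $s_1,\dots,s_k$. There is an absolute constant $C>0$ such that for all $k,n,s,c$ as above with $\sum_i s_i\le n/2$: if some deterministic $[c_1,\dots,c_k]$-bounded $k$-party protocol solves the problem with error at most $1\%$ under $D_{\mathfrak s}$, then $\sum_{i=1}^k c_i/s_i\ge C$. **(Equivalence of the two settings.)** For all $k,n,s,c$ as above with $\sum_i s_i\le n$ and every real $\delta$: if a randomized $[c_1,\dots,c_k]$-bounded protocol has error at most $\delta$ on every input satisfying the promise, then some deterministic $[c_1,\dots,c_k]$-bounded protocol has error at most $\delta$ under $D_{\mathfrak s}$; and if a deterministic $[c_1,\dots,c_k]$-bounded protocol has error at most $\delta$ under $D_{\mathfrak s}$, then some randomized $[c_1,\dots,c_k]$-bounded protocol has error at most $2\delta$ on every input satisfying the promise. -/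

import Mathlib

namespace UDisj

/-- An input to the `k` players: player `i` holds the subset `X i` of an `n`-element ground set. -/
abbrev Input (k n : ℕ) : Type := Fin k → Finset (Fin n)

/-- The pairwise disjoint promise case. -/
def IsDisjoint {k n : ℕ} (X : Input k n) : Prop :=
  ∀ i i' : Fin k, i ≠ i' → Disjoint (X i) (X i')

/-- The unique intersection promise case: some `x` lies in every set, and the sets are pairwise
disjoint once `x` is removed. -/
def IsUniqueIntersection {k n : ℕ} (X : Input k n) : Prop :=
  ∃ x : Fin n, (∀ i, x ∈ X i) ∧
    ∀ i i' : Fin k, i ≠ i' → Disjoint ((X i).erase x) ((X i').erase x)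

/-- The promise for the answer `b`: `true` stands for unique intersection, `false` for disjoint. -/
def Promise {k n : ℕ} (b : Bool) (X : Input k n) : Prop :=
  match b with
  | false => IsDisjoint X
  | true => IsUniqueIntersection X

/-- The input has the prescribed set sizes. -/
def HasSizes {k n : ℕ} (s : Fin k → ℕ) (X : Input k n) : Prop :=
  ∀ i, (X i).card = s i

/-- Deterministic `k`-party blackboard protocols, as finite trees. At an inner node (which is
determined by what has been written so far) player `i` writes the bit `msg (X i)`, computed from
that player's own input, on the blackboard. The output bit is determined by the transcript. -/
inductive Protocol (k n : ℕ) : Type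
  | output (b : Bool) : Protocol k n
  | speak (i : Fin k) (msg : Finset (Fin n) → Bool) (next : Bool → Protocol k n) : Protocol k n

namespace Protocol

/-- The transcript on input `X`: the bits written, each with the player who wrote it. -/
def transcript {k n : ℕ} : Protocol k n → Input k n → List (Fin k × Bool)
  | .output _, _ => []
  | .speak i msg next, X => (i, msg (X i)) :: transcript (next (msg (X i))) X

/-- The output on input `X`; `true` claims unique intersection, `false` claims disjointness. -/
def result {k n : ℕ} : Protocol k n → Input k n → Bool
  | .output b, _ => b
  | .speak i msg next, X => result (next (msg (X i))) X

/-- The number of bits that player `i` sends on input `X`. -/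
def bitsSent {k n : ℕ} (P : Protocol k n) (i : Fin k) (X : Input k n) : ℕ :=
  (P.transcript X).countP (fun e => decide (e.1 = i))

/-- `P` is `[c₁, …, c_k]`-bounded: in any transcript, player `i` sends at most `c i` bits. -/
def Bounded {k n : ℕ} (P : Protocol k n) (c : Fin k → ℕ) : Prop :=
  ∀ (X : Input k n) (i : Fin k), P.bitsSent i X ≤ c i

open Classical in
/-- All inputs with set sizes `s` in the promise case `b`. -/
noncomputable def sizedInputs {k n : ℕ} (s : Fin k → ℕ) (b : Bool) : Finset (Input k n) :=
  Finset.univ.filter (fun X => HasSizes s X ∧ Promise b X)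

/-- The probability that `P` answers `b` on a uniformly random input with set sizes `s` in the
promise case `b`. -/
noncomputable def successOn {k n : ℕ} (P : Protocol k n) (s : Fin k → ℕ) (b : Bool) : ℝ :=
  (((sizedInputs s b).filter (fun X => P.result X = b)).card : ℝ) /
    ((sizedInputs (n := n) s b).card : ℝ)

/-- `P` has error at most `δ` under the even mixture of the uniform distributions on the two
promise cases with set sizes `s`. -/
def SolvesUniform {k n : ℕ} (P : Protocol k n) (s : Fin k → ℕ) (δ : ℝ) : Prop :=
  1 - δ ≤ (1 / 2) * P.successOn s false + (1 / 2) * P.successOn s true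

end Protocol

/-- Randomized (public-coin) blackboard protocols: probability distributions on deterministic
ones. Private coins are covered: for each outcome of all the coins, public and private, what
remains is a deterministic protocol. (There are only countably many deterministic protocols.) -/
abbrev RandProtocol (k n : ℕ) : Type := PMF (Protocol k n)

namespace RandProtocol

/-- In any transcript (any outcome of the coins, any input) player `i` sends at most `c i` bits. -/
def Bounded {k n : ℕ} (R : RandProtocol k n) (c : Fin k → ℕ) : Prop :=
  ∀ P ∈ R.support, P.Bounded c

/-- The probability, over the coins, that the output on the fixed input `X` is `b`. -/
noncomputable def probResult {k n : ℕ} (R : RandProtocol k n) (X : Input k n) (b : Bool) : ℝ :=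
  ((R.map (fun P => P.result X)) b).toReal

/-- `R` solves unique set-disjointness with set sizes `s` with error at most `δ` on every input
that satisfies the promise. -/
def Solves {k n : ℕ} (R : RandProtocol k n) (s : Fin k → ℕ) (δ : ℝ) : Prop :=
  ∀ (b : Bool) (X : Input k n), HasSizes s X → Promise b X → 1 - δ ≤ R.probResult X b

end RandProtocol

end UDisj

/-!
The two settings are related by averaging. If a randomized protocol is good on every input, then
some outcome of its coins is good on a random input. Conversely, renaming the ground set by a
random permutation turns any fixed input of a promise class into a uniformly random one
(`card_mul_sum_relabel`), because the permutations act transitively on the inputs of given sizes in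
a given promise class. This also reduces the lower bound for randomized protocols to that for
deterministic protocols on uniform inputs, which is proved for every error below `1 / 2`
(`le_sum_div_of_solvesUniform`).

The lower bound is an information argument in terms of Hellinger distances. Place in the ground set
`s i` pairs of elements for each player `i`, all elements distinct, except that one pair of each
player contains a common element `z` (a `Layout`); there is room for this because
`2 * ∑ i, s i ≤ n`. Each player chooses one element of each of its pairs at random. If nobody chooses
`z`, the input is disjoint, and if everybody does, it is a unique intersection; with the layout
relabelled at random both inputs are uniform. For a set `S` of players, let `P_S` be the
distribution of the transcript when exactly the players in `S` choose `z`.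

* If only player `i` may choose `z`, the protocol cannot see which of the `s i` pairs of that player
  is the special one. The message of the player has at most `2 ^ c i` values and so carries little
  information on its `s i` independent bits in total; by the level-one inequality
  (`sum_sq_bias_le`) and symmetry, the squared Hellinger distance of `P_∅` and `P_{i}` is at most a
  constant times `c i / s i` on average (`Layout.mul_sum_sqDist_singleton_le`).
* The inputs with a given transcript form a rectangle, whence `P_S P_T = P_∅ P_{S ∪ T}` for disjoint
  `S` and `T`. So the distance of `P_S` and `P_T` is that of `P_∅` and `P_{S ∪ T}`. Comparing the
  pairwise distances of points with the distances from a fixed point and merging the players in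
  pairs `m` times loses only the convergent product `∏ (1 - 2⁻ʲ)`. Hence the squared distance of
  `P_∅` and `P_[k]` is at most `4` times the sum of the squared distances of `P_∅` and `P_{i}`
  (`CutPaste.sqDist_univ_le`).
* A protocol that decides the problem tells `P_∅` from `P_[k]`, so their distance is bounded below
  (`Layout.sq_answerCount_sub_le`).
-/

namespace UDisj

open Finset

variable {k n : ℕ}

/-! ### Symmetries of the ground set -/

theorem exists_perm_comp_eq {α β : Type*} [Fintype α] [DecidableEq α] {f g : β → α}
    (hf : Function.Injective f) (hg : Function.Injective g) :
    ∃ τ : Equiv.Perm α, ∀ b, τ (f b) = g b := by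
  classical
  let e : {x // x ∈ Set.range f} ≃ {x // x ∈ Set.range g} :=
    (Equiv.ofInjective f hf).symm.trans (Equiv.ofInjective g hg)
  refine ⟨e.extendSubtype, fun b => ?_⟩
  rw [Equiv.extendSubtype_apply_of_mem e (f b) ⟨b, rfl⟩]
  have : (Equiv.ofInjective f hf).symm ⟨f b, b, rfl⟩ = b := by
    rw [Equiv.symm_apply_eq]; rfl
  change ((Equiv.ofInjective g hg) ((Equiv.ofInjective f hf).symm ⟨f b, b, rfl⟩) : α) = g b
  rw [this]; rfl

/-- Two families of pairwise disjoint finite sets with the same cardinalities differ by a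
permutation of the ambient finite type. -/
theorem exists_perm_map_eq {α ι : Type*} [Fintype α] [DecidableEq α] {A B : ι → Finset α}
    (hA : ∀ i i', i ≠ i' → Disjoint (A i) (A i')) (hB : ∀ i i', i ≠ i' → Disjoint (B i) (B i'))
    (h : ∀ i, (A i).card = (B i).card) :
    ∃ τ : Equiv.Perm α, ∀ i, (A i).map τ.toEmbedding = B i := by
  have key : ∀ (C : ι → Finset α), (∀ i i', i ≠ i' → Disjoint (C i) (C i')) →
      Function.Injective (fun p : (Σ i, C i) => (p.2 : α)) := by
    rintro C hC ⟨i, x, hx⟩ ⟨i', x', hx'⟩ hxx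
    obtain rfl : x = x' := hxx
    obtain rfl : i = i' := by
      by_contra hi
      exact Finset.disjoint_left.1 (hC i i' hi) hx hx'
    rfl
  let e : ∀ i, A i ≃ B i := fun i => Finset.equivOfCardEq (h i)
  obtain ⟨τ, hτ⟩ := exists_perm_comp_eq (key A hA)
    ((key B hB).comp (Equiv.sigmaCongrRight e).injective)
  refine ⟨τ, fun i => Finset.eq_of_subset_of_card_le ?_ (by simp [h i])⟩
  intro y hy
  obtain ⟨x, hx, rfl⟩ := Finset.mem_map.1 hy
  have := hτ ⟨i, x, hx⟩
  simp only [Equiv.coe_toEmbedding] at this ⊢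
  rw [this]
  exact (e i ⟨x, hx⟩).2

/-- The input obtained by renaming the elements of the ground set by `σ`. -/
def relabel (σ : Equiv.Perm (Fin n)) (X : Input k n) : Input k n :=
  fun i => (X i).map σ.toEmbedding

theorem relabel_mul (σ τ : Equiv.Perm (Fin n)) (X : Input k n) :
    relabel (σ * τ) X = relabel σ (relabel τ X) := by
  funext i; simp only [relabel, Finset.map_map]; rfl

theorem relabel_inv_relabel (σ : Equiv.Perm (Fin n)) (X : Input k n) :
    relabel σ⁻¹ (relabel σ X) = X := by
  rw [← relabel_mul, inv_mul_cancel]; funext i; exact Finset.map_refl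

theorem HasSizes.relabel {s : Fin k → ℕ} {X : Input k n} (h : HasSizes s X)
    (σ : Equiv.Perm (Fin n)) : HasSizes s (relabel σ X) := fun i => by
  simpa [UDisj.relabel] using h i

theorem Promise.relabel {b : Bool} {X : Input k n} (h : Promise b X)
    (σ : Equiv.Perm (Fin n)) : Promise b (relabel σ X) := by
  cases b with
  | false => exact fun i i' hi => (Finset.disjoint_map _).2 (h i i' hi)
  | true =>
    obtain ⟨x, hx, hd⟩ := h
    refine ⟨σ x, fun i => by simpa [UDisj.relabel] using hx i, fun i i' hi => ?_⟩
    have := (Finset.disjoint_map σ.toEmbedding).2 (hd i i' hi)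
    rwa [Finset.map_erase, Finset.map_erase] at this

theorem Promise.exists_relabel_eq {s : Fin k → ℕ} {b : Bool} {X Y : Input k n}
    (hX : Promise b X) (hY : Promise b Y) (sX : HasSizes s X) (sY : HasSizes s Y) :
    ∃ σ, UDisj.relabel σ X = Y := by
  cases b with
  | false =>
    obtain ⟨σ, h⟩ := exists_perm_map_eq hX hY (fun i => by rw [sX i, sY i])
    exact ⟨σ, funext h⟩
  | true =>
    obtain ⟨x, hx, hxd⟩ := hX
    obtain ⟨y, hy, hyd⟩ := hY
    -- The common element together with the remainders of the sets is a disjoint family.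
    have key : ∀ (Z : Input k n) (z : Fin n),
        (∀ i i', i ≠ i' → Disjoint ((Z i).erase z) ((Z i').erase z)) →
        ∀ o o' : Option (Fin k), o ≠ o' →
          Disjoint (o.elim {z} (fun i => (Z i).erase z))
            (o'.elim {z} (fun i => (Z i).erase z)) := by
      intro Z z hZ o o' ho
      cases o <;> cases o' <;> simp at ho ⊢
      exact hZ _ _ ho
    obtain ⟨σ, h⟩ := exists_perm_map_eq (key X x hxd) (key Y y hyd) (by
      intro o
      cases o with
      | none => simp
      | some i => simp [Finset.card_erase_of_mem, hx i, hy i, sX i, sY i])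
    have h0 : σ x = y := by simpa using h none
    refine ⟨σ, funext fun i => ?_⟩
    have h1 := h (some i)
    simp only [Option.elim_some] at h1
    rw [UDisj.relabel, ← Finset.insert_erase (hx i), Finset.map_insert, h1]
    simp [h0, Finset.insert_erase (hy i)]

theorem mem_sizedInputs {s : Fin k → ℕ} {b : Bool} {X : Input k n} :
    X ∈ Protocol.sizedInputs s b ↔ HasSizes s X ∧ Promise b X := by
  simp [Protocol.sizedInputs]

/-- Relabelling one fixed input of a promise class by a uniformly random permutation gives a
uniformly random input of that class. -/
theorem card_mul_sum_relabel {s : Fin k → ℕ} {b : Bool} {X : Input k n}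
    (hX : X ∈ Protocol.sizedInputs s b) (f : Input k n → ℝ) :
    ((Protocol.sizedInputs (n := n) s b).card : ℝ) * ∑ σ : Equiv.Perm (Fin n), f (relabel σ X) =
      (Fintype.card (Equiv.Perm (Fin n)) : ℝ) * ∑ Y ∈ Protocol.sizedInputs s b, f Y := by
  rw [mem_sizedInputs] at hX
  have h1 : ∀ Y ∈ Protocol.sizedInputs (n := n) s b,
      ∑ σ : Equiv.Perm (Fin n), f (relabel σ Y) = ∑ σ, f (relabel σ X) := by
    intro Y hY
    rw [mem_sizedInputs] at hY
    obtain ⟨τ, rfl⟩ := hX.2.exists_relabel_eq hY.2 hX.1 hY.1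
    simp_rw [← relabel_mul]
    exact Equiv.sum_comp (Equiv.mulRight τ) (fun σ => f (relabel σ X))
  have h2 : ∀ σ : Equiv.Perm (Fin n), ∑ Y ∈ Protocol.sizedInputs s b, f (relabel σ Y) =
      ∑ Y ∈ Protocol.sizedInputs (k := k) s b, f Y := by
    intro σ
    refine Finset.sum_nbij' (relabel σ) (relabel σ⁻¹) ?_ ?_ ?_ ?_ (fun _ _ => rfl)
    · intro Y hY; rw [mem_sizedInputs] at hY ⊢; exact ⟨hY.1.relabel σ, hY.2.relabel σ⟩
    · intro Y hY; rw [mem_sizedInputs] at hY ⊢; exact ⟨hY.1.relabel σ⁻¹, hY.2.relabel σ⁻¹⟩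
    · intro Y _; exact relabel_inv_relabel σ Y
    · intro Y _; simpa using relabel_inv_relabel σ⁻¹ Y
  calc _ = ∑ Y ∈ Protocol.sizedInputs s b, ∑ σ : Equiv.Perm (Fin n), f (relabel σ Y) := by
        rw [Finset.sum_congr rfl h1]; simp
    _ = _ := by rw [Finset.sum_comm, Finset.sum_congr rfl (fun σ _ => h2 σ)]; simp

theorem successOn_eq_average {s : Fin k → ℕ} {b : Bool} {X : Input k n}
    (hX : X ∈ Protocol.sizedInputs s b) (P : Protocol k n) :
    P.successOn s b = (∑ σ : Equiv.Perm (Fin n), if P.result (relabel σ X) = b then (1 : ℝ) else 0) /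
      (Fintype.card (Equiv.Perm (Fin n)) : ℝ) := by
  have h := card_mul_sum_relabel hX (fun Y => if P.result Y = b then (1 : ℝ) else 0)
  have h1 : ((Protocol.sizedInputs (n := n) s b).card : ℝ) ≠ 0 := by
    exact_mod_cast (Finset.card_pos.2 ⟨X, hX⟩).ne'
  have h2 : (Fintype.card (Equiv.Perm (Fin n)) : ℝ) ≠ 0 := by
    exact_mod_cast Fintype.card_ne_zero
  rw [Protocol.successOn, div_eq_div_iff h1 h2, mul_comm, mul_comm (∑ _, _), h]
  congr 1
  rw [Finset.sum_boole]

namespace Protocol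

/-- The protocol in which the players first rename the ground set by `σ` and then run `P`. -/
def relabel (σ : Equiv.Perm (Fin n)) : Protocol k n → Protocol k n
  | .output b => .output b
  | .speak i msg next =>
    .speak i (fun A => msg (A.map σ.toEmbedding)) (fun b => relabel σ (next b))

theorem transcript_relabel (σ : Equiv.Perm (Fin n)) (P : Protocol k n) (X : Input k n) :
    (P.relabel σ).transcript X = P.transcript (UDisj.relabel σ X) := by
  induction P with
  | output b => rfl
  | speak i msg next ih => simp [relabel, transcript, ih, UDisj.relabel]

theorem result_relabel (σ : Equiv.Perm (Fin n)) (P : Protocol k n) (X : Input k n) :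
    (P.relabel σ).result X = P.result (UDisj.relabel σ X) := by
  induction P with
  | output b => rfl
  | speak i msg next ih => simp [relabel, result, ih, UDisj.relabel]

theorem successOn_le_one (P : Protocol k n) (s : Fin k → ℕ) (b : Bool) :
    P.successOn s b ≤ 1 :=
  div_le_one_of_le₀ (by exact_mod_cast Finset.card_filter_le _ _) (by positivity)

end Protocol

/-! ### Equivalence of the two settings -/

theorem exists_rand_of_solvesUniform {s c : Fin k → ℕ} {δ : ℝ} {P : Protocol k n}
    (hP : P.Bounded c) (h : P.SolvesUniform s δ) :
    ∃ R : RandProtocol k n, R.Bounded c ∧ R.Solves s (2 * δ) := by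
  refine ⟨(PMF.uniformOfFintype (Equiv.Perm (Fin n))).map (fun σ => P.relabel σ), ?_, ?_⟩
  · intro Q hQ X i
    rw [PMF.mem_support_map_iff] at hQ
    obtain ⟨σ, -, rfl⟩ := hQ
    rw [Protocol.bitsSent, Protocol.transcript_relabel]
    exact hP _ i
  · intro b X hs hp
    have key : RandProtocol.probResult
        ((PMF.uniformOfFintype (Equiv.Perm (Fin n))).map (fun σ => P.relabel σ)) X b =
        P.successOn s b := by
      rw [successOn_eq_average (mem_sizedInputs.2 ⟨hs, hp⟩), RandProtocol.probResult, PMF.map_comp,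
        PMF.map_apply, tsum_fintype, ENNReal.toReal_sum
          (fun σ _ => by split_ifs <;> simp), Finset.sum_div]
      refine Finset.sum_congr rfl fun σ _ => ?_
      simp only [Function.comp_apply, Protocol.result_relabel, PMF.uniformOfFintype_apply,
        eq_comm (a := b)]
      split_ifs <;> simp
    rw [key]
    have h0 := P.successOn_le_one s false
    have h1 := P.successOn_le_one s true
    unfold Protocol.SolvesUniform at h
    cases b <;> linarith

theorem successOn_eq_sum (P : Protocol k n) (s : Fin k → ℕ) (b : Bool) :
    P.successOn s b = ∑ X ∈ Protocol.sizedInputs s b,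
      ((Protocol.sizedInputs (n := n) s b).card : ℝ)⁻¹ * if P.result X = b then 1 else 0 := by
  rw [← Finset.mul_sum, Finset.sum_boole, Protocol.successOn, div_eq_inv_mul]

theorem hasSum_probResult (R : RandProtocol k n) (X : Input k n) (b : Bool) :
    HasSum (fun P => (R P).toReal * if P.result X = b then 1 else 0) (R.probResult X b) := by
  have hfin : ∀ P : Protocol k n, (if b = P.result X then R P else 0) ≠ ⊤ := fun P => by
    split_ifs <;> simp [PMF.apply_ne_top]
  have h : ∑' P : Protocol k n, (if b = P.result X then R P else 0) ≠ ⊤ := by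
    have := PMF.apply_ne_top (R.map (fun P => P.result X)) b
    rw [PMF.map_apply] at this
    convert this
  have := ENNReal.hasSum_toReal h
  rw [← ENNReal.tsum_toReal_eq hfin] at this
  rw [RandProtocol.probResult, PMF.map_apply]
  convert this using 1
  · funext P
    by_cases hb : P.result X = b
    · simp [hb]
    · simp [hb, Ne.symm hb]
  · congr!

/-- Averaging over the coins: some outcome of the coins of a randomized protocol is at least as
good on the uniform distribution as the randomized protocol is in the worst case. -/
theorem exists_solvesUniform_of_rand {s c : Fin k → ℕ} {δ : ℝ}
    (hne : ∀ b, (Protocol.sizedInputs (n := n) s b).Nonempty) {R : RandProtocol k n}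
    (hR : R.Bounded c) (h : R.Solves s δ) :
    ∃ P : Protocol k n, P.Bounded c ∧ P.SolvesUniform s δ := by
  set g : Protocol k n → ℝ := fun P => (1 / 2) * P.successOn s false + (1 / 2) * P.successOn s true
    with hg
  have hsum : ∀ b, ∃ v : ℝ, 1 - δ ≤ v ∧
      HasSum (fun P : Protocol k n => (R P).toReal * P.successOn s b) v := by
    intro b
    refine ⟨∑ X ∈ Protocol.sizedInputs s b,
      ((Protocol.sizedInputs (n := n) s b).card : ℝ)⁻¹ * R.probResult X b, ?_, ?_⟩
    · have hc : ((Protocol.sizedInputs (n := n) s b).card : ℝ) ≠ 0 := by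
        exact_mod_cast (Finset.card_pos.2 (hne b)).ne'
      calc 1 - δ = ∑ X ∈ Protocol.sizedInputs (n := n) s b,
            ((Protocol.sizedInputs (n := n) s b).card : ℝ)⁻¹ * (1 - δ) := by
            rw [Finset.sum_const, nsmul_eq_mul]; field_simp
        _ ≤ _ := Finset.sum_le_sum fun X hX => by
            rw [mem_sizedInputs] at hX
            exact mul_le_mul_of_nonneg_left (h b X hX.1 hX.2) (by positivity)
    · have := hasSum_sum (s := Protocol.sizedInputs (n := n) s b) fun X _ =>
        (hasSum_probResult R X b).mul_left ((Protocol.sizedInputs (n := n) s b).card : ℝ)⁻¹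
      refine (congrArg (HasSum · _) (funext fun P => ?_)).mpr this
      rw [successOn_eq_sum, Finset.mul_sum]
      exact Finset.sum_congr rfl fun X _ => by ring
  obtain ⟨v0, hv0, hs0⟩ := hsum false
  obtain ⟨v1, hv1, hs1⟩ := hsum true
  have hsg : HasSum (fun P => (R P).toReal * g P) ((1 / 2) * v0 + (1 / 2) * v1) := by
    refine (congrArg (HasSum · _) (funext fun P => ?_)).mpr
      ((hs0.mul_left (1 / 2)).add (hs1.mul_left (1 / 2)))
    simp only [hg]; ring
  have hs1 : HasSum (fun P => (R P).toReal * (1 - δ)) (1 * (1 - δ)) := by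
    refine HasSum.mul_right _ ?_
    have := ENNReal.hasSum_toReal R.tsum_coe_ne_top
    rwa [← ENNReal.tsum_toReal_eq (fun P => PMF.apply_ne_top R P), R.tsum_coe,
      ENNReal.toReal_one] at this
  by_contra hcon
  push Not at hcon
  have hlt : ∀ P ∈ R.support, g P < 1 - δ := fun P hP => by
    exact not_le.1 (hcon P (hR P hP))
  obtain ⟨P, hP⟩ := R.support_nonempty
  have hpos : 0 < (R P).toReal :=
    ENNReal.toReal_pos ((PMF.mem_support_iff _ _).1 hP) (PMF.apply_ne_top R P)
  have hle : ∀ Q, (R Q).toReal * g Q ≤ (R Q).toReal * (1 - δ) := fun Q => by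
    by_cases hQ : Q ∈ R.support
    · exact mul_le_mul_of_nonneg_left (hlt Q hQ).le ENNReal.toReal_nonneg
    · rw [PMF.mem_support_iff, not_not] at hQ
      simp [hQ]
  have := hasSum_lt (i := P) hle (mul_lt_mul_of_pos_left (hlt P hP) hpos) hsg hs1
  linarith

/-! ### Information about single coordinates of a cube -/

/-- The sign `±1` encoding a bit. -/
def sgn (b : Bool) : ℝ := if b then -1 else 1

/-- Level-one inequality: a set of density `α` in the discrete cube has coordinate biases whose
squares add up to at most `2 log (1 / α)`. Here the biases are left unnormalised. -/
theorem sum_sq_bias_le {ι : Type*} [Fintype ι] [DecidableEq ι] (A : Finset (ι → Bool))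
    (hA : A.Nonempty) :
    ∑ j, (∑ x ∈ A, sgn (x j)) ^ 2 / (A.card : ℝ) ≤
      2 * (A.card * Real.log (2 ^ Fintype.card ι / A.card)) := by
  have ha : (0 : ℝ) < A.card := by exact_mod_cast hA.card_pos
  set a : ℝ := (A.card : ℝ) with ha'
  set β : ι → ℝ := fun j => (∑ x ∈ A, sgn (x j)) / a with hβ
  set B : ℝ := ∑ j, β j ^ 2 with hB
  -- Exponential moment of the linear form with coefficients `β` over the whole cube.
  have hcube : ∑ x : ι → Bool, Real.exp (∑ j, β j * sgn (x j)) ≤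
      2 ^ Fintype.card ι * Real.exp (B / 2) := by
    calc ∑ x : ι → Bool, Real.exp (∑ j, β j * sgn (x j))
        = ∏ j, ∑ b : Bool, Real.exp (β j * sgn b) := by
          simp_rw [Real.exp_sum]
          rw [Finset.prod_univ_sum, Fintype.piFinset_univ]
      _ = ∏ j, (2 * Real.cosh (β j)) := by
          refine Finset.prod_congr rfl fun j _ => ?_
          simp [sgn, Real.cosh_eq]; ring
      _ ≤ ∏ j, (2 * Real.exp (β j ^ 2 / 2)) :=
          Finset.prod_le_prod (fun j _ => by positivity) fun j _ => by
            gcongr; exact Real.cosh_le_exp_half_sq _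
      _ = 2 ^ Fintype.card ι * Real.exp (B / 2) := by
          rw [Finset.prod_mul_distrib, ← Real.exp_sum, hB, Finset.sum_div]
          simp
  -- The average of that form over `A` is `B`; Jensen's inequality for `exp`, by its tangent at `B`.
  have havg : ∑ x ∈ A, ∑ j, β j * sgn (x j) = a * B := by
    rw [Finset.sum_comm, hB, Finset.mul_sum]
    refine Finset.sum_congr rfl fun j _ => ?_
    rw [← Finset.mul_sum]
    simp only [hβ]; field_simp
  have hjensen : a * Real.exp B ≤ ∑ x ∈ A, Real.exp (∑ j, β j * sgn (x j)) := by
    have h1 : ∀ x ∈ A, Real.exp B * ((∑ j, β j * sgn (x j)) - B + 1) ≤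
        Real.exp (∑ j, β j * sgn (x j)) := fun x _ => by
      have := Real.add_one_le_exp ((∑ j, β j * sgn (x j)) - B)
      calc _ ≤ Real.exp B * Real.exp ((∑ j, β j * sgn (x j)) - B) := by gcongr
        _ = _ := by rw [← Real.exp_add]; congr 1; ring
    refine le_trans (le_of_eq ?_) (Finset.sum_le_sum h1)
    rw [← Finset.mul_sum, Finset.sum_add_distrib, Finset.sum_sub_distrib, havg]
    simp only [Finset.sum_const, nsmul_eq_mul]
    ring
  have hle : a * Real.exp B ≤ 2 ^ Fintype.card ι * Real.exp (B / 2) :=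
    hjensen.trans ((Finset.sum_le_univ_sum_of_nonneg fun x => (Real.exp_pos _).le).trans hcube)
  have hexp : Real.exp (B / 2) ≤ 2 ^ Fintype.card ι / a := by
    rw [le_div_iff₀ ha]
    have : Real.exp B = Real.exp (B / 2) * Real.exp (B / 2) := by
      rw [← Real.exp_add]; congr 1; ring
    rw [this] at hle
    have hp := Real.exp_pos (B / 2)
    nlinarith
  have hlog : B / 2 ≤ Real.log (2 ^ Fintype.card ι / a) := by
    rw [Real.le_log_iff_exp_le (by positivity)]; exact hexp
  calc ∑ j, (∑ x ∈ A, sgn (x j)) ^ 2 / a = a * B := by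
        rw [hB, Finset.mul_sum]
        refine Finset.sum_congr rfl fun j _ => ?_
        simp only [hβ]; field_simp
    _ ≤ _ := by nlinarith

/-- Entropy bound: a partition into `N` classes has entropy at most `log N`. -/
theorem sum_card_mul_log_le {α T : Type*} [Fintype α] [DecidableEq T] (f : α → T) (M : ℝ)
    (hM : M = Fintype.card α) (hM0 : 0 < M) :
    ∑ t ∈ univ.image f, ((univ.filter (f · = t)).card : ℝ) *
        Real.log (M / (univ.filter (f · = t)).card) ≤ M * Real.log (univ.image f).card := by
  set N : ℝ := ((univ.image f).card : ℝ) with hN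
  have hcard : ∑ t ∈ univ.image f, ((univ.filter (f · = t)).card : ℝ) = M := by
    rw [hM, ← Finset.card_univ]
    exact_mod_cast (Finset.card_eq_sum_card_image f univ).symm
  have hne : (univ.image f).Nonempty := by
    rw [Finset.nonempty_iff_ne_empty]
    intro h; rw [h] at hcard; simp at hcard; linarith
  have hN0 : 0 < N := by rw [hN]; exact_mod_cast hne.card_pos
  have hterm : ∀ t ∈ univ.image f, ((univ.filter (f · = t)).card : ℝ) *
        Real.log (M / (univ.filter (f · = t)).card) ≤
      ((univ.filter (f · = t)).card : ℝ) * (Real.log N - 1) + M / N := by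
    intro t ht
    obtain ⟨x, -, hx⟩ := Finset.mem_image.1 ht
    have ha : (0 : ℝ) < (univ.filter (f · = t)).card := by
      exact_mod_cast Finset.card_pos.2 ⟨x, by simp [hx]⟩
    set a : ℝ := ((univ.filter (f · = t)).card : ℝ)
    have h1 := Real.log_le_sub_one_of_pos (show 0 < M / a / N by positivity)
    rw [Real.log_div (by positivity) hN0.ne'] at h1
    have h2 : a * Real.log (M / a) ≤ a * (Real.log N + (M / a / N - 1)) := by
      gcongr; linarith
    refine h2.trans (le_of_eq ?_)
    field_simp
    ring
  refine (Finset.sum_le_sum hterm).trans (le_of_eq ?_)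
  rw [Finset.sum_add_distrib, ← Finset.sum_mul, hcard]
  simp only [Finset.sum_const, nsmul_eq_mul]
  rw [← hN]; field_simp; ring

theorem sum_sgn_eq {α : Type*} (A : Finset α) (g : α → Bool) :
    ∑ x ∈ A, sgn (g x) =
      ((A.filter (g · = false)).card : ℝ) - ((A.filter (g · = true)).card : ℝ) := by
  have : ∀ b : Bool, sgn b = (if b = false then (1 : ℝ) else 0) - (if b = true then 1 else 0) := by
    intro b; cases b <;> simp [sgn]
  simp_rw [this, Finset.sum_sub_distrib, Finset.sum_boole]

theorem card_filter_add_card_filter {α : Type*} (A : Finset α) (g : α → Bool) :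
    ((A.filter (g · = false)).card : ℝ) + ((A.filter (g · = true)).card : ℝ) = A.card := by
  have := Finset.card_filter_add_card_filter_not (s := A) (fun x => g x = false)
  simp only [Bool.not_eq_false] at this
  exact_mod_cast this

theorem sqrt_sub_sqrt_sq_le {a b : ℝ} (ha : 0 ≤ a) (hb : 0 ≤ b) :
    (√a - √b) ^ 2 ≤ (a - b) ^ 2 / (a + b) := by
  rcases (add_nonneg ha hb).eq_or_lt with h | h
  · obtain rfl : a = 0 := by linarith
    obtain rfl : b = 0 := by linarith
    simp
  · rw [le_div_iff₀ h]
    obtain ⟨x, hx, rfl⟩ : ∃ x, 0 ≤ x ∧ a = x ^ 2 := ⟨√a, Real.sqrt_nonneg _, (Real.sq_sqrt ha).symm⟩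
    obtain ⟨y, hy, rfl⟩ : ∃ x, 0 ≤ x ∧ b = x ^ 2 := ⟨√b, Real.sqrt_nonneg _, (Real.sq_sqrt hb).symm⟩
    rw [Real.sqrt_sq hx, Real.sqrt_sq hy]
    have : (x ^ 2 - y ^ 2) ^ 2 = (x - y) ^ 2 * (x ^ 2 + y ^ 2) + (x - y) ^ 2 * (2 * (x * y)) := by ring
    rw [this]
    have : 0 ≤ (x - y) ^ 2 * (2 * (x * y)) := by positivity
    linarith

/-- For a message `f` on the discrete cube: the (unnormalised) squared Hellinger distance between
the distributions of the message conditioned on the two values of the bit `j`. -/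
noncomputable def bitHellinger {ι T : Type*} [Fintype ι] [DecidableEq ι] [DecidableEq T]
    (f : (ι → Bool) → T) (j : ι) : ℝ :=
  ∑ t ∈ univ.image f, (√((univ.filter (fun y => f y = t ∧ y j = false)).card : ℝ) -
    √((univ.filter (fun y => f y = t ∧ y j = true)).card : ℝ)) ^ 2

/-- A message with `N` possible values tells, in total over all coordinates of the cube, at most
`2 log N`. -/
theorem sum_bitHellinger_le {ι T : Type*} [Fintype ι] [DecidableEq ι] [DecidableEq T]
    (f : (ι → Bool) → T) :
    ∑ j, bitHellinger f j ≤
      2 * (2 ^ Fintype.card ι * Real.log (univ.image f).card) := by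
  have hent := sum_card_mul_log_le f (2 ^ Fintype.card ι) (by simp) (by positivity)
  unfold bitHellinger
  rw [Finset.sum_comm]
  calc _ ≤ ∑ t ∈ univ.image f, 2 * (((univ.filter (f · = t)).card : ℝ) *
        Real.log (2 ^ Fintype.card ι / (univ.filter (f · = t)).card)) := by
        refine Finset.sum_le_sum fun t ht => ?_
        obtain ⟨x, -, hx⟩ := Finset.mem_image.1 ht
        refine le_trans (Finset.sum_le_sum fun j _ => ?_)
          (sum_sq_bias_le (univ.filter (f · = t)) ⟨x, by simp [hx]⟩)
        refine (sqrt_sub_sqrt_sq_le (by positivity) (by positivity)).trans (le_of_eq ?_)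
        rw [sum_sgn_eq, ← card_filter_add_card_filter (univ.filter (f · = t)) (fun x => x j)]
        simp only [Finset.filter_filter]
    _ ≤ _ := by rw [← Finset.mul_sum]; gcongr

/-! ### Superadditivity of Hellinger distances -/

/-- A uniformly random permutation takes two distinct points to a uniformly random ordered pair of
distinct points. -/
theorem sum_perm_pair {ι : Type*} [Fintype ι] [DecidableEq ι] (F : ι → ι → ℝ) {x y : ι}
    (hxy : x ≠ y) :
    ((Fintype.card ι : ℝ) * (Fintype.card ι - 1)) * ∑ e : Equiv.Perm ι, F (e x) (e y) =
      Fintype.card (Equiv.Perm ι) * ∑ p ∈ (univ : Finset ι).offDiag, F p.1 p.2 := by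
  have h1 : ∀ p ∈ (univ : Finset ι).offDiag,
      ∑ e : Equiv.Perm ι, F (e p.1) (e p.2) = ∑ e : Equiv.Perm ι, F (e x) (e y) := by
    rintro ⟨a, b⟩ hp
    have hab : a ≠ b := by simpa using hp
    have inj : ∀ {a b : ι}, a ≠ b → Function.Injective (fun t : Bool => if t then a else b) := by
      intro a b hab s t
      cases s <;> cases t <;> simp [hab, hab.symm]
    obtain ⟨τ, hτ⟩ := exists_perm_comp_eq (inj hxy) (inj hab)
    have ha : τ x = a := by simpa using hτ true
    have hb : τ y = b := by simpa using hτ false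
    rw [← ha, ← hb]
    exact Equiv.sum_comp (Equiv.mulRight τ) (fun e : Equiv.Perm ι => F (e x) (e y))
  have h2 : ∀ e : Equiv.Perm ι, ∑ p ∈ (univ : Finset ι).offDiag, F (e p.1) (e p.2) =
      ∑ p ∈ (univ : Finset ι).offDiag, F p.1 p.2 := fun e => by
    refine Finset.sum_equiv (e.prodCongr e) (fun p => by simp) (fun p _ => by simp)
  have h3 : ((univ : Finset ι).offDiag.card : ℝ) =
      (Fintype.card ι : ℝ) * (Fintype.card ι - 1) := by
    rw [Finset.offDiag_card, Finset.card_univ, Nat.cast_sub (Nat.le_mul_self _)]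
    push_cast; ring
  calc _ = ∑ p ∈ (univ : Finset ι).offDiag, ∑ e : Equiv.Perm ι, F (e p.1) (e p.2) := by
        rw [Finset.sum_congr rfl h1, ← h3]; simp
    _ = _ := by rw [Finset.sum_comm, Finset.sum_congr rfl (fun e _ => h2 e)]; simp

section CutPaste

variable {α Ω : Type*} (W : Finset Ω) (v : Finset α → Ω → ℝ)

/-- Squared `ℓ²` distance between `v ∅` and `v S`. -/
def sqDist (S : Finset α) : ℝ := ∑ t ∈ W, (v ∅ t - v S t) ^ 2

theorem sqDist_empty : sqDist W v ∅ = 0 := by simp [sqDist]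

theorem sqDist_nonneg (S : Finset α) : 0 ≤ sqDist W v S :=
  Finset.sum_nonneg fun _ _ => sq_nonneg _

variable [DecidableEq α]

/-- A family of vectors of equal norm, indexed by sets, with the cut-and-paste property of
(square roots of) transcript distributions. -/
structure CutPaste (M : ℝ) : Prop where
  norm_sq : ∀ S, ∑ t ∈ W, v S t ^ 2 = M
  paste : ∀ S T, Disjoint S T → ∀ t ∈ W, v S t * v T t = v ∅ t * v (S ∪ T) t

variable {W v} {M : ℝ}

theorem CutPaste.sum_sub_sq (h : CutPaste W v M) {S T : Finset α} (hST : Disjoint S T) :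
    ∑ t ∈ W, (v S t - v T t) ^ 2 = sqDist W v (S ∪ T) := by
  have e : ∀ S T : Finset α, ∑ t ∈ W, (v S t - v T t) ^ 2 = 2 * M - 2 * ∑ t ∈ W, v S t * v T t := by
    intro S T
    have h1 : ∀ t, (v S t - v T t) ^ 2 = v S t ^ 2 + v T t ^ 2 - 2 * (v S t * v T t) := by
      intro t; ring
    simp_rw [h1]
    rw [Finset.sum_sub_distrib, Finset.sum_add_distrib, h.norm_sq, h.norm_sq, ← Finset.mul_sum]
    ring
  rw [sqDist, e, e, Finset.sum_congr rfl (h.paste S T hST)]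

/-- The centroid inequality, combined with cut-and-paste: distances of pairwise unions are
controlled by distances of single sets. -/
theorem CutPaste.sum_offDiag_le (h : CutPaste W v M) {ι : Type*} [Fintype ι] [DecidableEq ι]
    {A : ι → Finset α} (hA : ∀ i j, i ≠ j → Disjoint (A i) (A j)) :
    ∑ p ∈ (univ : Finset ι).offDiag, sqDist W v (A p.1 ∪ A p.2) ≤
      2 * Fintype.card ι * ∑ i, sqDist W v (A i) := by
  have h1 : ∑ p ∈ (univ : Finset ι).offDiag, sqDist W v (A p.1 ∪ A p.2) =
      ∑ p ∈ (univ : Finset ι).offDiag, ∑ t ∈ W, (v (A p.1) t - v (A p.2) t) ^ 2 :=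
    Finset.sum_congr rfl fun p hp => (h.sum_sub_sq (hA _ _ (by simpa using hp))).symm
  rw [h1]
  calc _ ≤ ∑ p : ι × ι, ∑ t ∈ W, (v (A p.1) t - v (A p.2) t) ^ 2 :=
        Finset.sum_le_univ_sum_of_nonneg fun p => Finset.sum_nonneg fun t _ => sq_nonneg _
    _ = ∑ t ∈ W, ∑ i, ∑ j, (v (A i) t - v (A j) t) ^ 2 := by
        rw [Finset.sum_comm]
        exact Finset.sum_congr rfl fun t _ => Fintype.sum_prod_type _
    _ ≤ ∑ t ∈ W, 2 * Fintype.card ι * ∑ i, (v ∅ t - v (A i) t) ^ 2 := by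
        refine Finset.sum_le_sum fun t _ => ?_
        have e : ∀ i j, (v (A i) t - v (A j) t) ^ 2 = (v ∅ t - v (A i) t) ^ 2 +
            (v ∅ t - v (A j) t) ^ 2 - 2 * ((v ∅ t - v (A i) t) * (v ∅ t - v (A j) t)) := by
          intro i j; ring
        simp_rw [e, Finset.sum_sub_distrib, Finset.sum_add_distrib, ← Finset.mul_sum,
          ← Finset.sum_mul]
        simp only [Finset.sum_const, Finset.card_univ, nsmul_eq_mul, ← Finset.mul_sum]
        have := mul_self_nonneg (∑ i, (v ∅ t - v (A i) t))
        linarith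
    _ = _ := by
        rw [← Finset.mul_sum, Finset.sum_comm]; rfl

/-- The constants `∏_{j ≤ m} (1 - 2⁻ʲ)`. -/
noncomputable def halvingProd : ℕ → ℝ
  | 0 => 1
  | m + 1 => halvingProd m * (1 - (1 / 2) ^ (m + 1))

theorem quarter_le_halvingProd (m : ℕ) : 1 / 4 ≤ halvingProd m := by
  -- The stronger bound makes the induction go through.
  have key : ∀ m, 1 / 4 * (1 + (1 / 2) ^ m) ≤ halvingProd (m + 1) := by
    intro m
    induction m with
    | zero => norm_num [halvingProd]
    | succ m ih =>
      rw [halvingProd]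
      have hp : (0 : ℝ) < (1 / 2) ^ m := by positivity
      have hp1 : ((1 : ℝ) / 2) ^ m ≤ 1 := pow_le_one₀ (by norm_num) (by norm_num)
      have e1 : ((1 : ℝ) / 2) ^ (m + 1) = (1 / 2) ^ m / 2 := by ring
      have e2 : ((1 : ℝ) / 2) ^ (m + 1 + 1) = (1 / 2) ^ m / 4 := by ring
      rw [e1, e2]
      generalize ((1 : ℝ) / 2) ^ m = t at *
      calc 1 / 4 * (1 + t / 2) ≤ 1 / 4 * (1 + t) * (1 - t / 4) := by nlinarith
        _ ≤ _ := by gcongr; linarith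
  cases m with
  | zero => norm_num [halvingProd]
  | succ m =>
    refine le_trans ?_ (key m)
    have hp : (0 : ℝ) < (1 / 2) ^ m := by positivity
    linarith

/-- Merge the sets of a disjoint family in random pairs, again and again: each round costs only a
factor `1 - 2⁻ʲ`, so that the total loss is bounded. -/
theorem CutPaste.halvingProd_mul_le (h : CutPaste W v M) (m : ℕ) :
    ∀ {ι : Type} [Fintype ι] [DecidableEq ι] (A : ι → Finset α), Fintype.card ι = 2 ^ m →
      (∀ i j, i ≠ j → Disjoint (A i) (A j)) →
      halvingProd m * sqDist W v (univ.biUnion A) ≤ ∑ i, sqDist W v (A i) := by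
  induction m with
  | zero =>
    intro ι _ _ A hι _
    obtain ⟨i, hi⟩ := Fintype.card_eq_one_iff.1 (by simpa using hι)
    have hu : (univ : Finset ι) = {i} := by ext j; simp [hi j]
    simp [hu, halvingProd]
  | succ m ih =>
    intro ι _ _ A hι hA
    let r : Fin (2 ^ m) × Bool ≃ ι := Fintype.equivOfCardEq (by simp [hι, pow_succ])
    have step : ∀ e : Equiv.Perm ι, halvingProd m * sqDist W v (univ.biUnion A) ≤
        ∑ d, sqDist W v (A (e (r (d, false))) ∪ A (e (r (d, true)))) := by
      intro e
      have hd : ∀ p q : Fin (2 ^ m) × Bool, p ≠ q → Disjoint (A (e (r p))) (A (e (r q))) :=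
        fun p q hpq => hA _ _ fun hc => hpq (r.injective (e.injective hc))
      have := ih (fun d => A (e (r (d, false))) ∪ A (e (r (d, true)))) (by simp) (by
        intro d d' hdd
        simp only [Finset.disjoint_union_left, Finset.disjoint_union_right]
        refine ⟨⟨?_, ?_⟩, ?_, ?_⟩ <;> exact hd _ _ (by simp [hdd]))
      convert this using 3
      ext x
      simp only [Finset.mem_biUnion, Finset.mem_univ, true_and, Finset.mem_union]
      constructor
      · rintro ⟨i, hi⟩
        obtain ⟨⟨d, b⟩, rfl⟩ := (r.trans e).surjective i
        cases b
        · exact ⟨d, Or.inl hi⟩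
        · exact ⟨d, Or.inr hi⟩
      · rintro ⟨d, hd | hd⟩
        · exact ⟨_, hd⟩
        · exact ⟨_, hd⟩
    set φ := sqDist W v (univ.biUnion A)
    set Φ := ∑ i, sqDist W v (A i)
    set F : ℝ := (Fintype.card (Equiv.Perm ι) : ℝ)
    have hF : 0 < F := Nat.cast_pos.2 Fintype.card_pos
    set N : ℝ := (Fintype.card ι : ℝ) with hN
    have hN2 : N = 2 ^ (m + 1) := by rw [hN, hι]; norm_num
    have hN1 : 2 ≤ N := by
      rw [hN2, pow_succ]
      have : (1 : ℝ) ≤ 2 ^ m := one_le_pow₀ (by norm_num)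
      linarith
    have hsum : F * (halvingProd m * φ) ≤
        ∑ d, ∑ e : Equiv.Perm ι, sqDist W v (A (e (r (d, false))) ∪ A (e (r (d, true)))) := by
      rw [Finset.sum_comm]
      calc F * (halvingProd m * φ) = ∑ _e : Equiv.Perm ι, halvingProd m * φ := by simp [F]
        _ ≤ _ := Finset.sum_le_sum fun e _ => step e
    have hpair := h.sum_offDiag_le hA
    have hmain : (N * (N - 1)) * (F * (halvingProd m * φ)) ≤ (N / 2) * (F * (2 * N * Φ)) := by
      calc _ ≤ (N * (N - 1)) * ∑ d, ∑ e : Equiv.Perm ι,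
              sqDist W v (A (e (r (d, false))) ∪ A (e (r (d, true)))) :=
            mul_le_mul_of_nonneg_left hsum (by nlinarith)
        _ = ∑ _d : Fin (2 ^ m), F * ∑ p ∈ (univ : Finset ι).offDiag,
              sqDist W v (A p.1 ∪ A p.2) := by
            rw [Finset.mul_sum]
            exact Finset.sum_congr rfl fun d _ =>
              sum_perm_pair (fun i j => sqDist W v (A i ∪ A j)) (by simp)
        _ ≤ ∑ _d : Fin (2 ^ m), F * (2 * N * Φ) :=
            Finset.sum_le_sum fun d _ => by gcongr
        _ = _ := by
            simp only [Finset.sum_const, Finset.card_univ, Fintype.card_fin, nsmul_eq_mul]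
            rw [hN2]; push_cast; ring
    have h2 : (N - 1) * (halvingProd m * φ) ≤ N * Φ := by
      have hNF : 0 < N * F := by positivity
      refine le_of_mul_le_mul_left ?_ hNF
      calc _ = (N * (N - 1)) * (F * (halvingProd m * φ)) := by ring
        _ ≤ _ := hmain
        _ = _ := by ring
    have h3 : (1 / 2 : ℝ) ^ (m + 1) = 1 / N := by rw [hN2]; simp
    rw [halvingProd, h3]
    refine le_of_mul_le_mul_left ?_ (show 0 < N by linarith)
    calc _ = (N - 1) * (halvingProd m * φ) := by field_simp
      _ ≤ _ := h2

theorem CutPaste.sqDist_univ_le {k : ℕ} {v : Finset (Fin k) → Ω → ℝ} (h : CutPaste W v M) :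
    sqDist W v univ ≤ 4 * ∑ i, sqDist W v {i} := by
  -- Pad the family of singletons with empty sets: index by all `2 ^ k` subsets.
  let A : Finset (Fin k) → Finset (Fin k) := fun S => if S.card = 1 then S else ∅
  have hA : ∀ S T, S ≠ T → Disjoint (A S) (A T) := by
    intro S T hST
    simp only [A]
    split_ifs with h1 h2
    · obtain ⟨a, rfl⟩ := Finset.card_eq_one.1 h1
      obtain ⟨b, rfl⟩ := Finset.card_eq_one.1 h2
      simpa using hST
    all_goals simp
  have h1 := h.halvingProd_mul_le k A (by simp) hA
  have hu : univ.biUnion A = univ := by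
    ext i
    simp only [Finset.mem_biUnion, Finset.mem_univ, true_and, iff_true]
    exact ⟨{i}, by simp [A]⟩
  have hs : ∑ S, sqDist W v (A S) = ∑ i, sqDist W v {i} := by
    symm
    refine Finset.sum_of_injOn (fun i => ({i} : Finset (Fin k)))
      (fun _ _ _ _ hij => Finset.singleton_injective hij) (by simp) ?_ ?_
    · intro S _ hS
      have : S.card ≠ 1 := fun hc => by
        obtain ⟨a, rfl⟩ := Finset.card_eq_one.1 hc
        exact hS ⟨a, by simp⟩
      simp [A, this, sqDist_empty]
    · intro i _; simp [A]
  rw [hu, hs] at h1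
  have h2 := quarter_le_halvingProd k
  have h3 := sqDist_nonneg (W := W) (v := v) univ
  nlinarith

end CutPaste

/-! ### Transcripts -/

namespace Protocol

theorem result_eq_of_transcript_eq (P : Protocol k n) {X Y : Input k n}
    (h : P.transcript X = P.transcript Y) : P.result X = P.result Y := by
  induction P with
  | output b => rfl
  | speak i msg next ih =>
    simp only [transcript, List.cons.injEq, Prod.mk.injEq, true_and] at h
    simp only [result, h.1] at h ⊢
    exact ih _ h.2

/-- The inputs leading to a given transcript form a combinatorial rectangle. (There has to be a
player, for a rectangle with no sides is never empty.) -/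
theorem exists_rectangle (i₀ : Fin k) (P : Protocol k n) (t : List (Fin k × Bool)) :
    ∃ R : Fin k → Finset (Fin n) → Bool, ∀ X, P.transcript X = t ↔ ∀ i, R i (X i) = true := by
  induction P generalizing t with
  | output b => exact ⟨fun _ _ => decide (t = []), fun X => by
      simp only [transcript, decide_eq_true_eq]
      exact ⟨fun h _ => h.symm, fun h => (h i₀).symm⟩⟩
  | speak i msg next ih =>
    match t with
    | [] => exact ⟨fun _ _ => false, fun X => by
        simp only [transcript, reduceCtorEq, false_iff, not_forall]; exact ⟨i, by simp⟩⟩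
    | (j, b) :: t =>
      obtain ⟨R, hR⟩ := ih b t
      by_cases hij : i = j
      · subst hij
        refine ⟨fun i' A => decide (R i' A = true ∧ (i' = i → msg A = b)), fun X => ?_⟩
        simp only [transcript, List.cons.injEq, Prod.mk.injEq, true_and, decide_eq_true_eq,
          forall_and, ← hR X]
        constructor
        · rintro ⟨h, h'⟩
          rw [h] at h'
          exact ⟨h', fun i' hi => hi ▸ h⟩
        · rintro ⟨h, h'⟩
          have := h' i rfl
          rw [this]
          exact ⟨rfl, h⟩
      · exact ⟨fun _ _ => false, fun X => by
          simp only [transcript, List.cons.injEq, Prod.mk.injEq, hij, false_and, false_iff,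
            not_forall]
          exact ⟨i, by simp⟩⟩

/-- With the inputs of all other players fixed, a player sending at most `c` bits produces at most
`2 ^ c` different transcripts. -/
theorem card_image_transcript_le (P : Protocol k n) (i : Fin k) {β : Type*}
    [DecidableEq β] (g : β → Input k n)
    (hg : ∀ y y' i', i' ≠ i → g y i' = g y' i') (T : Finset β) (c : ℕ)
    (hc : ∀ y ∈ T, P.bitsSent i (g y) ≤ c) :
    (T.image (fun y => P.transcript (g y))).card ≤ 2 ^ c := by
  induction P generalizing T c with
  | output b =>
    refine (Finset.card_le_card (t := {[]}) ?_).trans (by simpa using Nat.one_le_two_pow)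
    intro t; simp [transcript]
  | speak i' msg next ih =>
    -- The inputs of `T` on which the bit `b` is written first.
    have hsub : ∀ (b : Bool) (T' : Finset β), (∀ y ∈ T', msg (g y i') = b) → ∀ c' : ℕ,
        (∀ y ∈ T', (next b).bitsSent i (g y) ≤ c') →
        (T'.image (fun y => (speak i' msg next).transcript (g y))).card ≤ 2 ^ c' := by
      intro b T' hT' c' hc'
      have : T'.image (fun y => (speak i' msg next).transcript (g y)) =
          (T'.image (fun y => (next b).transcript (g y))).image (List.cons (i', b)) := by
        rw [Finset.image_image]
        refine Finset.image_congr fun y hy => ?_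
        simp [transcript, hT' y hy]
      rw [this]
      exact Finset.card_image_le.trans (ih b T' c' hc')
    by_cases hi : i' = i
    · subst hi
      rcases T.eq_empty_or_nonempty with rfl | ⟨y₀, hy₀⟩
      · simp
      have hbits : ∀ y, (speak i' msg next).bitsSent i' (g y) =
          (next (msg (g y i'))).bitsSent i' (g y) + 1 := by
        intro y; simp [bitsSent, transcript]
      obtain ⟨c, rfl⟩ : ∃ c', c = c' + 1 := by
        have := hc y₀ hy₀
        rw [hbits] at this
        exact ⟨c - 1, by omega⟩
      have hT : T = T.filter (fun y => msg (g y i') = true) ∪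
          T.filter (fun y => msg (g y i') = false) := by
        ext y; cases h : msg (g y i') <;> simp [h]
      have hb : ∀ b, ((T.filter (fun y => msg (g y i') = b)).image
          (fun y => (speak i' msg next).transcript (g y))).card ≤ 2 ^ c := by
        intro b
        refine hsub b _ (fun y hy => (Finset.mem_filter.1 hy).2) c fun y hy => ?_
        obtain ⟨hy, hyb⟩ := Finset.mem_filter.1 hy
        have := hc y hy
        rw [hbits, hyb] at this
        omega
      rw [hT, Finset.image_union, pow_succ, mul_two]
      exact (Finset.card_union_le _ _).trans (add_le_add (hb _) (hb _))
    · rcases T.eq_empty_or_nonempty with rfl | ⟨y₀, hy₀⟩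
      · simp
      have hm : ∀ y ∈ T, msg (g y i') = msg (g y₀ i') := fun y _ => by rw [hg y y₀ i' hi]
      refine hsub _ T hm c fun y hy => ?_
      have := hc y hy
      simpa [bitsSent, transcript, hi, hm y hy] using this

/-- The set of all transcripts of `P`. -/
def transcripts (P : Protocol k n) : Finset (List (Fin k × Bool)) :=
  univ.image P.transcript

theorem transcript_mem_transcripts (P : Protocol k n) (X : Input k n) :
    P.transcript X ∈ P.transcripts := Finset.mem_image_of_mem _ (Finset.mem_univ X)

end Protocol

/-! ### Layouts: inputs built from random pairs of elements -/

/-- The input in which player `i` holds the elements `g i j`. -/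
def ofLabels {s : Fin k → ℕ} (g : ∀ i, Fin (s i) → Fin n) : Input k n :=
  fun i => univ.image (g i)

theorem hasSizes_ofLabels {s : Fin k → ℕ} {g : ∀ i, Fin (s i) → Fin n}
    (hg : ∀ i, Function.Injective (g i)) : HasSizes s (ofLabels g) := fun i => by
  simp [ofLabels, Finset.card_image_of_injective _ (hg i)]

theorem isDisjoint_ofLabels {s : Fin k → ℕ} {g : ∀ i, Fin (s i) → Fin n}
    (hg : ∀ i j i' j', i ≠ i' → g i j ≠ g i' j') : IsDisjoint (ofLabels g) := by
  intro i i' hi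
  rw [Finset.disjoint_left]
  intro x hx hx'
  obtain ⟨j, -, rfl⟩ := Finset.mem_image.1 hx
  obtain ⟨j', -, h⟩ := Finset.mem_image.1 hx'
  exact hg i j i' j' hi h.symm

theorem isUniqueIntersection_ofLabels {s : Fin k → ℕ} {g : ∀ i, Fin (s i) → Fin n} {z : Fin n}
    {o : ∀ i, Fin (s i)} (hz : ∀ i, g i (o i) = z)
    (hg : ∀ i j i' j', i ≠ i' → g i j = g i' j' → j = o i) :
    IsUniqueIntersection (ofLabels g) := by
  refine ⟨z, fun i => Finset.mem_image.2 ⟨o i, by simp, hz i⟩, fun i i' hi => ?_⟩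
  rw [Finset.disjoint_left]
  intro x hx hx'
  rw [Finset.mem_erase] at hx hx'
  obtain ⟨j, -, rfl⟩ := Finset.mem_image.1 hx.2
  obtain ⟨j', -, h⟩ := Finset.mem_image.1 hx'.2
  obtain rfl := hg i j i' j' hi h.symm
  exact hx.1 (hz i)

/-- A layout: every player `i` has `s i` pairs `(u i j, w i j)` of elements of the ground set. All
these elements are distinct, except that the pair number `o i` of each player has the same second
element `z`. -/
structure Layout (n : ℕ) (s : Fin k → ℕ) (o : ∀ i, Fin (s i)) where
  u : ∀ i, Fin (s i) → Fin n
  w : ∀ i, Fin (s i) → Fin n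
  z : Fin n
  w_o : ∀ i, w i (o i) = z
  u_ne_w : ∀ i j i' j', u i j ≠ w i' j'
  u_inj : ∀ i, Function.Injective (u i)
  u_ne : ∀ i j i' j', i ≠ i' → u i j ≠ u i' j'
  w_inj : ∀ i, Function.Injective (w i)
  w_ne : ∀ i j i' j', i ≠ i' → w i j = w i' j' → j = o i

namespace Layout

variable {s : Fin k → ℕ} {o : ∀ i, Fin (s i)} (L : Layout n s o)

/-- The element of the `j`-th pair of player `i` selected by a bit. -/
def pick (i : Fin k) (j : Fin (s i)) (b : Bool) : Fin n := if b then L.w i j else L.u i j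

/-- The input in which each player holds one element of each of its pairs, as selected by `x`. -/
def input (x : ∀ i, Fin (s i) → Bool) : Input k n := ofLabels fun i j => L.pick i j (x i j)

theorem pick_injective (i : Fin k) (y : Fin (s i) → Bool) :
    Function.Injective (fun j => L.pick i j (y j)) := by
  intro j j' h
  simp only [pick] at h
  split_ifs at h
  · exact L.w_inj i h
  · exact absurd h.symm (L.u_ne_w _ _ _ _)
  · exact absurd h (L.u_ne_w _ _ _ _)
  · exact L.u_inj i h

theorem pick_eq_pick {i i' : Fin k} (hi : i ≠ i') {j : Fin (s i)} {j' : Fin (s i')} {b b' : Bool}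
    (h : L.pick i j b = L.pick i' j' b') : b = true ∧ j = o i := by
  simp only [pick] at h
  split_ifs at h with h1 h2
  · exact ⟨h1, L.w_ne i j i' j' hi h⟩
  · exact absurd h.symm (L.u_ne_w _ _ _ _)
  · exact absurd h (L.u_ne_w _ _ _ _)
  · exact absurd h (L.u_ne _ _ _ _ hi)

theorem hasSizes_input (x : ∀ i, Fin (s i) → Bool) : HasSizes s (L.input x) :=
  hasSizes_ofLabels fun i => L.pick_injective i (x i)

theorem input_mem_sizedInputs {x : ∀ i, Fin (s i) → Bool} {b : Bool} (hx : ∀ i, x i (o i) = b) :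
    L.input x ∈ Protocol.sizedInputs s b := by
  refine mem_sizedInputs.2 ⟨L.hasSizes_input x, ?_⟩
  cases b with
  | false =>
    refine isDisjoint_ofLabels fun i j i' j' hi h => ?_
    obtain ⟨h1, rfl⟩ := L.pick_eq_pick hi h
    simp [hx] at h1
  | true =>
    exact isUniqueIntersection_ofLabels (z := L.z) (o := o) (fun i => by simp [pick, hx, L.w_o])
      fun i j i' j' hi h => (L.pick_eq_pick hi h).2

/-- The layout obtained by renaming the elements of the ground set. -/
def perm (σ : Equiv.Perm (Fin n)) : Layout n s o where
  u i j := σ (L.u i j)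
  w i j := σ (L.w i j)
  z := σ L.z
  w_o i := by rw [L.w_o]
  u_ne_w i j i' j' h := L.u_ne_w i j i' j' (σ.injective h)
  u_inj i := σ.injective.comp (L.u_inj i)
  u_ne i j i' j' hi h := L.u_ne i j i' j' hi (σ.injective h)
  w_inj i := σ.injective.comp (L.w_inj i)
  w_ne i j i' j' hi h := L.w_ne i j i' j' hi (σ.injective h)

theorem input_perm (σ : Equiv.Perm (Fin n)) (x : ∀ i, Fin (s i) → Bool) :
    (L.perm σ).input x = relabel σ (L.input x) := by
  funext i
  simp only [input, ofLabels, relabel, Finset.map_eq_image, Finset.image_image]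
  congr 1
  funext j
  simp only [pick, perm, Function.comp_apply, Equiv.coe_toEmbedding]
  split_ifs <;> rfl

/-- The permutation of the ground set that exchanges the `j`-th pair of player `i` with its pair
containing the element `z`. -/
def swapPair (i : Fin k) (j : Fin (s i)) : Equiv.Perm (Fin n) :=
  Equiv.swap (L.u i (o i)) (L.u i j) * Equiv.swap (L.w i (o i)) (L.w i j)

theorem swapPair_pick_self (i : Fin k) (j l : Fin (s i)) (b : Bool) :
    L.swapPair i j (L.pick i l b) = L.pick i (Equiv.swap (o i) j l) b := by
  cases b with
  | false =>
    simp only [pick, swapPair, Equiv.Perm.mul_apply, Bool.false_eq_true, if_false]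
    rw [Equiv.swap_apply_of_ne_of_ne (L.u_ne_w _ _ _ _) (L.u_ne_w _ _ _ _),
      (L.u_inj i).swap_apply]
  | true =>
    simp only [pick, swapPair, Equiv.Perm.mul_apply, if_true]
    rw [(L.w_inj i).swap_apply,
      Equiv.swap_apply_of_ne_of_ne (L.u_ne_w _ _ _ _).symm (L.u_ne_w _ _ _ _).symm]

theorem swapPair_pick_of_ne {i i' : Fin k} (hi : i' ≠ i) (j : Fin (s i)) {l : Fin (s i')}
    {b : Bool} (hb : l = o i' → b = false) :
    L.swapPair i j (L.pick i' l b) = L.pick i' l b := by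
  have key : ∀ m b', L.pick i' l b ≠ L.pick i m b' := fun m b' h => by
    obtain ⟨h1, h2⟩ := L.pick_eq_pick hi h
    rw [hb h2] at h1; simp at h1
  have ku : ∀ m, L.pick i' l b ≠ L.u i m := fun m => key m false
  have kw : ∀ m, L.pick i' l b ≠ L.w i m := fun m => key m true
  rw [swapPair, Equiv.Perm.mul_apply, Equiv.swap_apply_of_ne_of_ne (kw _) (kw _),
    Equiv.swap_apply_of_ne_of_ne (ku _) (ku _)]

/-- If no player except possibly `i` holds `z`, then exchanging two pairs of player `i` in the
ground set amounts to exchanging the corresponding two bits of that player. -/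
theorem relabel_swapPair_input (i : Fin k) (j : Fin (s i)) {x : ∀ i, Fin (s i) → Bool}
    (hx : ∀ i', i' ≠ i → x i' (o i') = false) (y : Fin (s i) → Bool) :
    relabel (L.swapPair i j) (L.input (Function.update x i y)) =
      L.input (Function.update x i (y ∘ Equiv.swap (o i) j)) := by
  funext i'
  simp only [input, ofLabels, relabel, Finset.map_eq_image, Finset.image_image]
  by_cases hi : i' = i
  · subst hi
    simp only [Function.update_self]
    have : (⇑(L.swapPair i' j).toEmbedding ∘ fun l => L.pick i' l (y l)) =
        (fun l => L.pick i' l ((y ∘ Equiv.swap (o i') j) l)) ∘ Equiv.swap (o i') j := by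
      funext l
      simp [swapPair_pick_self]
    rw [this, ← Finset.image_image, Finset.image_univ_equiv]
  · simp only [Function.update_of_ne hi]
    congr 1
    funext l
    exact L.swapPair_pick_of_ne hi j fun h => h ▸ hx i' hi

theorem exists_layout (hk : 0 < k) (h : 2 * ∑ i, s i ≤ n) : Nonempty (Layout n s o) := by
  obtain ⟨ℓ⟩ : Nonempty ((Σ i, Fin (s i)) × Bool ↪ Fin n) :=
    Function.Embedding.nonempty_of_card_le (by simp; omega)
  have inj : ∀ i (j : Fin (s i)) i' (j' : Fin (s i')) b b',
      ℓ (⟨i, j⟩, b) = ℓ (⟨i', j'⟩, b') → (⟨i, j⟩ : Σ i, Fin (s i)) = ⟨i', j'⟩ ∧ b = b' := by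
    intro i j i' j' b b' h
    simpa using ℓ.injective h
  let i₀ : Fin k := ⟨0, hk⟩
  refine ⟨{
    u := fun i j => ℓ (⟨i, j⟩, false)
    w := fun i j => if j = o i then ℓ (⟨i₀, o i₀⟩, true) else ℓ (⟨i, j⟩, true)
    z := ℓ (⟨i₀, o i₀⟩, true)
    w_o := fun i => by simp
    u_ne_w := fun i j i' j' h => ?_
    u_inj := fun i j j' h => by simpa using (inj _ _ _ _ _ _ h).1
    u_ne := fun i j i' j' hi h => hi (congrArg Sigma.fst (inj _ _ _ _ _ _ h).1)
    w_inj := fun i j j' h => ?_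
    w_ne := fun i j i' j' hi h => ?_ }⟩
  · split_ifs at h <;> simpa using (inj _ _ _ _ _ _ h).2
  · have aux : ∀ l : Fin (s i), ℓ (⟨i₀, o i₀⟩, true) = ℓ (⟨i, l⟩, true) → l = o i := by
      intro l hl
      have := (inj _ _ _ _ _ _ hl).1
      obtain rfl : i₀ = i := congrArg Sigma.fst this
      simpa using this.symm
    simp only at h
    split_ifs at h with h1 h2 h2
    · rw [h1, h2]
    · exact absurd (aux _ h) h2
    · exact absurd (aux _ h.symm) h1
    · simpa using (inj _ _ _ _ _ _ h).1
  · have aux : ∀ i (l : Fin (s i)), ℓ (⟨i₀, o i₀⟩, true) = ℓ (⟨i, l⟩, true) → l = o i := by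
      intro i l hl
      have := (inj _ _ _ _ _ _ hl).1
      obtain rfl : i₀ = i := congrArg Sigma.fst this
      simpa using this.symm
    by_contra hj
    simp only [hj, if_false] at h
    split_ifs at h
    · exact hj (aux _ _ h.symm)
    · exact hi (congrArg Sigma.fst (inj _ _ _ _ _ _ h).1)

end Layout

theorem sizedInputs_nonempty {s : Fin k → ℕ} (hk : 0 < k) (hs : ∀ i, 1 ≤ s i)
    (h : ∑ i, s i ≤ n) (b : Bool) : (Protocol.sizedInputs (n := n) s b).Nonempty := by
  obtain ⟨ℓ⟩ : Nonempty ((Σ i, Fin (s i)) ↪ Fin n) :=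
    Function.Embedding.nonempty_of_card_le (by simpa using h)
  have inj : ∀ i (j : Fin (s i)) i' (j' : Fin (s i')), ℓ ⟨i, j⟩ = ℓ ⟨i', j'⟩ →
      (⟨i, j⟩ : Σ i, Fin (s i)) = ⟨i', j'⟩ := fun i j i' j' h => ℓ.injective h
  cases b with
  | false =>
    refine ⟨ofLabels (s := s) fun i j => ℓ ⟨i, j⟩, mem_sizedInputs.2 ⟨hasSizes_ofLabels ?_,
      isDisjoint_ofLabels ?_⟩⟩
    · intro i j j' h; simpa using inj _ _ _ _ h
    · intro i j i' j' hi h; exact hi (congrArg Sigma.fst (inj _ _ _ _ h))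
  | true =>
    let i₀ : Fin k := ⟨0, hk⟩
    let o : ∀ i, Fin (s i) := fun i => ⟨0, hs i⟩
    have aux : ∀ i (l : Fin (s i)), ℓ ⟨i₀, o i₀⟩ = ℓ ⟨i, l⟩ → l = o i := by
      intro i l hl
      have := inj _ _ _ _ hl
      obtain rfl : i₀ = i := congrArg Sigma.fst this
      simpa using this.symm
    refine ⟨ofLabels (s := s) fun i j => if j = o i then ℓ ⟨i₀, o i₀⟩ else ℓ ⟨i, j⟩,
      mem_sizedInputs.2 ⟨hasSizes_ofLabels ?_,
        isUniqueIntersection_ofLabels (z := ℓ ⟨i₀, o i₀⟩) (o := o) (fun i => by simp) ?_⟩⟩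
    · intro i j j' h
      simp only at h
      split_ifs at h with h1 h2 h2
      · rw [h1, h2]
      · exact absurd (aux _ _ h) h2
      · exact absurd (aux _ _ h.symm) h1
      · simpa using inj _ _ _ _ h
    · intro i j i' j' hi h
      by_contra hj
      simp only [hj, if_false] at h
      split_ifs at h
      · exact hj (aux _ _ h.symm)
      · exact hi (congrArg Sigma.fst (inj _ _ _ _ h))

/-! ### The transcript distributions of a layout -/

theorem two_mul_card_filter_apply_eq {ι : Type*} [Fintype ι] [DecidableEq ι] (j : ι) (b : Bool) :
    2 * ((univ.filter (fun y : ι → Bool => y j = b)).card : ℝ) = 2 ^ Fintype.card ι := by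
  have h1 : (univ.filter (fun y : ι → Bool => y j = false)).card =
      (univ.filter (fun y : ι → Bool => y j = true)).card :=
    Finset.card_bij' (fun y _ l => !(y l)) (fun y _ l => !(y l)) (by simp) (by simp)
      (by simp) (by simp)
  have h2 := card_filter_add_card_filter (univ : Finset (ι → Bool)) (fun y => y j)
  rw [Finset.card_univ] at h2
  simp only [Fintype.card_pi, Fintype.card_bool, Finset.prod_const, Finset.card_univ,
    Nat.cast_pow, Nat.cast_ofNat] at h2
  cases b
  · rw [← h2, ← h1]; ring
  · rw [← h2, h1]; ring

theorem bitHellinger_comp_swap {ι T : Type*} [Fintype ι] [DecidableEq ι] [DecidableEq T]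
    (f : (ι → Bool) → T) (i j : ι) :
    bitHellinger (fun y => f (y ∘ Equiv.swap i j)) i = bitHellinger f j := by
  have inv : ∀ y : ι → Bool, (y ∘ Equiv.swap i j) ∘ Equiv.swap i j = y := fun y => by
    funext l; simp
  have himg : univ.image (fun y => f (y ∘ Equiv.swap i j)) = univ.image f := by
    ext t
    simp only [Finset.mem_image, Finset.mem_univ, true_and]
    exact ⟨fun ⟨y, hy⟩ => ⟨_, hy⟩, fun ⟨y, hy⟩ => ⟨y ∘ Equiv.swap i j, by rw [inv, hy]⟩⟩
  have hcard : ∀ t b, (univ.filter (fun y => f (y ∘ Equiv.swap i j) = t ∧ y i = b)).card =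
      (univ.filter (fun y => f y = t ∧ y j = b)).card := fun t b =>
    Finset.card_bij' (fun y _ => y ∘ Equiv.swap i j) (fun y _ => y ∘ Equiv.swap i j)
      (by simp) (by simp [inv]) (fun y _ => inv y) (fun y _ => inv y)
  simp only [bitHellinger, himg, hcard]

namespace Layout

variable {s : Fin k → ℕ} {o : ∀ i, Fin (s i)} (L : Layout n s o)

/-- The choices of elements in which exactly the players in `S` hold the common element `z`. -/
def face (o : ∀ i, Fin (s i)) (S : Finset (Fin k)) : Finset (∀ i, Fin (s i) → Bool) :=
  Fintype.piFinset fun i => univ.filter fun y => y (o i) = decide (i ∈ S)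

theorem mem_face {S : Finset (Fin k)} {x : ∀ i, Fin (s i) → Bool} :
    x ∈ face o S ↔ ∀ i, x i (o i) = decide (i ∈ S) := by
  simp [face]

/-- The number of elements of a face. -/
noncomputable def faceCard (s : Fin k → ℕ) : ℝ := ∏ i, (2 : ℝ) ^ s i / 2

theorem faceCard_pos (s : Fin k → ℕ) : 0 < faceCard s :=
  Finset.prod_pos fun _ _ => by positivity

theorem card_face (S : Finset (Fin k)) : ((face o S).card : ℝ) = faceCard s := by
  rw [face, Fintype.card_piFinset, faceCard, Nat.cast_prod]
  refine Finset.prod_congr rfl fun i _ => ?_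
  have := two_mul_card_filter_apply_eq (o i) (decide (i ∈ S))
  rw [Fintype.card_fin] at this
  rw [← this]; ring

/-- The number of choices for which exactly the players in `S` hold `z` and the transcript of `P`
is `t`. Up to the factor `faceCard s` this is a probability. -/
def law (P : Protocol k n) (S : Finset (Fin k)) (t : List (Fin k × Bool)) : ℕ :=
  ((face o S).filter fun x => P.transcript (L.input x) = t).card

/-- The contribution of player `i` to the rectangle `R`, for a given value of the bit deciding
whether the player holds `z`. -/
def sideCount (R : Fin k → Finset (Fin n) → Bool) (i : Fin k) (b : Bool) : ℕ :=
  (univ.filter fun y : Fin (s i) → Bool =>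
    y (o i) = b ∧ R i (univ.image fun j => L.pick i j (y j)) = true).card

variable {L} {P : Protocol k n} {t : List (Fin k × Bool)} {R : Fin k → Finset (Fin n) → Bool}

theorem law_eq_prod (hR : ∀ X, P.transcript X = t ↔ ∀ i, R i (X i) = true) (S : Finset (Fin k)) :
    L.law P S t = ∏ i, L.sideCount R i (decide (i ∈ S)) := by
  simp only [law, sideCount, ← Fintype.card_piFinset]
  congr 1
  ext x
  simp only [Finset.mem_filter, mem_face, hR, Fintype.mem_piFinset, Finset.mem_univ, true_and,
    forall_and]
  rfl

variable (L P) in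
theorem sum_law (S : Finset (Fin k)) :
    ∑ t ∈ P.transcripts, (L.law P S t : ℝ) = faceCard s := by
  rw [← card_face (o := o) S]
  exact_mod_cast (Finset.card_eq_sum_card_fiberwise
    (fun x _ => P.transcript_mem_transcripts (L.input x))).symm

theorem law_mul_law (i₀ : Fin k) {S T : Finset (Fin k)} (hST : Disjoint S T) :
    L.law P S t * L.law P T t = L.law P ∅ t * L.law P (S ∪ T) t := by
  obtain ⟨R, hR⟩ := P.exists_rectangle i₀ t
  simp only [law_eq_prod hR, ← Finset.prod_mul_distrib]
  refine Finset.prod_congr rfl fun i _ => ?_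
  by_cases hS : i ∈ S
  · have hT : i ∉ T := Finset.disjoint_left.1 hST hS
    simp [hS, hT, mul_comm]
  · simp [hS]

variable (L P) in
theorem law_cutPaste (i₀ : Fin k) :
    CutPaste P.transcripts (fun S t => √(L.law P S t : ℝ)) (faceCard s) := by
  refine ⟨fun S => ?_, fun S T hST t _ => ?_⟩
  · rw [← sum_law L P S]
    exact Finset.sum_congr rfl fun t _ => Real.sq_sqrt (Nat.cast_nonneg _)
  · simp only [← Real.sqrt_mul (Nat.cast_nonneg _), ← Nat.cast_mul]
    rw [law_mul_law i₀ hST]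

/-- The choices of all players other than `i` for which none of them holds `z`. (The choice of
player `i` is set to a default value.) -/
def others (o : ∀ i, Fin (s i)) (i : Fin k) : Finset (∀ i, Fin (s i) → Bool) :=
  Fintype.piFinset fun i' =>
    if i' = i then {fun _ => false} else univ.filter fun y => y (o i') = false

theorem apply_of_mem_others {i : Fin k} {x : ∀ i, Fin (s i) → Bool} (hx : x ∈ others o i) :
    ∀ i', i' ≠ i → x i' (o i') = false := fun i' hi => by
  have := Fintype.mem_piFinset.1 hx i'
  simpa [hi] using this

theorem card_others_mul (i : Fin k) : ((others o i).card : ℝ) * 2 ^ s i = 2 * faceCard s := by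
  have h : ((others o i).card : ℝ) = ∏ i' ∈ univ.erase i, (2 : ℝ) ^ s i' / 2 := by
    rw [others, Fintype.card_piFinset, ← Finset.mul_prod_erase univ _ (Finset.mem_univ i)]
    simp only [if_true, Finset.card_singleton, one_mul, Nat.cast_prod]
    refine Finset.prod_congr rfl fun i' hi => ?_
    rw [if_neg (Finset.ne_of_mem_erase hi)]
    have := two_mul_card_filter_apply_eq (o i') false
    rw [Fintype.card_fin] at this
    rw [← this]; ring
  rw [faceCard, ← Finset.mul_prod_erase univ _ (Finset.mem_univ i), h]; ring

variable (L P) in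
/-- The transcript as a function of the choice of player `i`, the others being fixed by `x`. -/
def message (i : Fin k) (x : ∀ i, Fin (s i) → Bool) (y : Fin (s i) → Bool) :
    List (Fin k × Bool) :=
  P.transcript (L.input (Function.update x i y))

theorem message_eq_iff (hR : ∀ X, P.transcript X = t ↔ ∀ i, R i (X i) = true) (i : Fin k)
    (x : ∀ i, Fin (s i) → Bool) (y : Fin (s i) → Bool) :
    L.message P i x y = t ↔ (∀ i', i' ≠ i → R i' (L.input x i') = true) ∧
      R i (univ.image fun j => L.pick i j (y j)) = true := by
  rw [message, hR]
  constructor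
  · refine fun h => ⟨fun i' hi => ?_, ?_⟩
    · have := h i'
      simpa only [input, ofLabels, Function.update_of_ne hi] using this
    · have := h i
      simpa only [input, ofLabels, Function.update_self] using this
  · rintro ⟨h, h'⟩ i'
    by_cases hi : i' = i
    · subst hi
      simpa only [input, ofLabels, Function.update_self] using h'
    · simpa only [input, ofLabels, Function.update_of_ne hi] using h i' hi

variable (L P) in
theorem sqDist_singleton (i : Fin k) :
    sqDist P.transcripts (fun S t => √(L.law P S t : ℝ)) {i} =
      ∑ x ∈ others o i, bitHellinger (L.message P i x) (o i) := by
  have hbit : ∀ x, bitHellinger (L.message P i x) (o i) = ∑ t ∈ P.transcripts,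
      (√((univ.filter (fun y => L.message P i x y = t ∧ y (o i) = false)).card : ℝ) -
        √((univ.filter (fun y => L.message P i x y = t ∧ y (o i) = true)).card : ℝ)) ^ 2 := by
    intro x
    refine Finset.sum_subset ?_ ?_
    · intro t ht
      obtain ⟨y, -, rfl⟩ := Finset.mem_image.1 ht
      exact P.transcript_mem_transcripts _
    · intro t _ ht
      have h : ∀ b, univ.filter (fun y => L.message P i x y = t ∧ y (o i) = b) = ∅ := by
        intro b
        refine Finset.filter_eq_empty_iff.2 fun y _ hy => ht ?_
        exact Finset.mem_image.2 ⟨y, Finset.mem_univ _, hy.1⟩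
      simp [h]
  simp_rw [hbit]
  rw [Finset.sum_comm, sqDist]
  refine Finset.sum_congr rfl fun t _ => ?_
  obtain ⟨R, hR⟩ := P.exists_rectangle i t
  -- Both laws share the factor `Q` contributed by the other players.
  set Q : ℕ := ∏ i' ∈ univ.erase i, L.sideCount R i' false with hQ
  have hlaw : ∀ S : Finset (Fin k), S ⊆ {i} →
      L.law P S t = Q * L.sideCount R i (decide (i ∈ S)) := by
    intro S hS
    rw [law_eq_prod hR, ← Finset.mul_prod_erase univ _ (Finset.mem_univ i), mul_comm, hQ]
    congr 1
    refine Finset.prod_congr rfl fun i' hi => ?_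
    have : i' ∉ S := fun h => Finset.ne_of_mem_erase hi (Finset.mem_singleton.1 (hS h))
    simp [this]
  have hQcard : Q = ((others o i).filter
      fun x => ∀ i', i' ≠ i → R i' (L.input x i') = true).card := by
    have : (others o i).filter (fun x => ∀ i', i' ≠ i → R i' (L.input x i') = true) =
        Fintype.piFinset fun i' => if i' = i then {fun _ => false} else
          univ.filter fun y : Fin (s i') → Bool =>
            y (o i') = false ∧ R i' (univ.image fun j => L.pick i' j (y j)) = true := by
      ext x
      simp only [others, Finset.mem_filter, Fintype.mem_piFinset, ← forall_and]
      refine forall_congr' fun i' => ?_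
      by_cases hi : i' = i
      · simp [hi]
      · simp only [hi, if_false, Finset.mem_filter, Finset.mem_univ, true_and, ne_eq,
          not_false_eq_true, true_imp_iff]
        rfl
    rw [this, Fintype.card_piFinset, ← Finset.mul_prod_erase univ _ (Finset.mem_univ i)]
    simp only [if_true, Finset.card_singleton, one_mul, hQ]
    refine Finset.prod_congr rfl fun i' hi => ?_
    rw [if_neg (Finset.ne_of_mem_erase hi)]
    rfl
  have hcount : ∀ x b, (univ.filter (fun y => L.message P i x y = t ∧ y (o i) = b)).card =
      if ∀ i', i' ≠ i → R i' (L.input x i') = true then L.sideCount R i b else 0 := by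
    intro x b
    simp only [message_eq_iff hR]
    split_ifs with h
    · simp only [sideCount]
      congr 1
      ext y
      simp only [Finset.mem_filter, Finset.mem_univ, true_and]
      tauto
    · simp [h]
  simp only [hcount]
  calc _ = (Q : ℝ) * (√(L.sideCount R i false : ℝ) - √(L.sideCount R i true : ℝ)) ^ 2 := by
        rw [hlaw ∅ (by simp), hlaw {i} subset_rfl]
        simp only [Finset.notMem_empty, decide_false, Finset.mem_singleton, decide_true,
          Nat.cast_mul]
        rw [Real.sqrt_mul (Nat.cast_nonneg _), Real.sqrt_mul (Nat.cast_nonneg _), ← mul_sub,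
          mul_pow, Real.sq_sqrt (Nat.cast_nonneg _)]
    _ = ∑ x ∈ others o i, if ∀ i', i' ≠ i → R i' (L.input x i') = true then
          (√(L.sideCount R i false : ℝ) - √(L.sideCount R i true : ℝ)) ^ 2 else 0 := by
        rw [hQcard, ← Finset.sum_filter, Finset.sum_const, nsmul_eq_mul]
    _ = _ := by
        refine Finset.sum_congr rfl fun x _ => ?_
        split_ifs <;> simp

variable (L) in
/-- All pairs of player `i` look the same to the protocol, once the ground set is relabelled at
random; hence the pair with `z` gets only its fair share of the information sent by player `i`. -/
theorem mul_sum_sqDist_singleton_le {c : Fin k → ℕ} (hP : P.Bounded c) (i : Fin k) :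
    (s i : ℝ) * ∑ σ : Equiv.Perm (Fin n),
        sqDist P.transcripts (fun S t => √((L.perm σ).law P S t : ℝ)) {i} ≤
      Fintype.card (Equiv.Perm (Fin n)) * (4 * faceCard s * c i) := by
  set F : ℝ := (Fintype.card (Equiv.Perm (Fin n)) : ℝ) with hF
  have hsymm : ∀ x ∈ others o i, ∀ j,
      ∑ σ : Equiv.Perm (Fin n), bitHellinger ((L.perm σ).message P i x) (o i) =
        ∑ σ : Equiv.Perm (Fin n), bitHellinger ((L.perm σ).message P i x) j := by
    intro x hx j
    rw [← Equiv.sum_comp (Equiv.mulRight (L.swapPair i j))]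
    refine Finset.sum_congr rfl fun σ _ => ?_
    rw [← bitHellinger_comp_swap _ (o i) j]
    congr 1
    funext y
    simp only [message, input_perm, Equiv.coe_mulRight, relabel_mul,
      L.relabel_swapPair_input i j (apply_of_mem_others hx)]
  have hx : ∀ x ∈ others o i, (s i : ℝ) *
      ∑ σ : Equiv.Perm (Fin n), bitHellinger ((L.perm σ).message P i x) (o i) ≤
        F * (2 * (2 ^ s i * c i)) := by
    intro x hx
    calc (s i : ℝ) * ∑ σ : Equiv.Perm (Fin n), bitHellinger ((L.perm σ).message P i x) (o i)
        = ∑ j, ∑ σ : Equiv.Perm (Fin n), bitHellinger ((L.perm σ).message P i x) j := by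
          rw [← Finset.sum_congr rfl (fun j _ => hsymm x hx j)]
          simp
      _ = ∑ σ : Equiv.Perm (Fin n), ∑ j, bitHellinger ((L.perm σ).message P i x) j :=
          Finset.sum_comm
      _ ≤ ∑ _σ : Equiv.Perm (Fin n), 2 * ((2 : ℝ) ^ s i * c i) := by
          refine Finset.sum_le_sum fun σ _ => (sum_bitHellinger_le _).trans ?_
          rw [Fintype.card_fin]
          gcongr
          have hcard : (univ.image ((L.perm σ).message P i x)).card ≤ 2 ^ c i :=
            P.card_image_transcript_le i
              (fun y => (L.perm σ).input (Function.update x i y)) (by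
                intro y y' i' hi
                simp only [input, ofLabels, Function.update_of_ne hi]) univ (c i)
              (fun y _ => hP _ i)
          have hpos : 0 < (univ.image ((L.perm σ).message P i x)).card :=
            Finset.card_pos.2 (Finset.univ_nonempty.image _)
          calc Real.log ((univ.image ((L.perm σ).message P i x)).card : ℝ)
              ≤ Real.log ((2 : ℝ) ^ c i) :=
                Real.log_le_log (by exact_mod_cast hpos) (by exact_mod_cast hcard)
            _ = c i * Real.log 2 := Real.log_pow _ _
            _ ≤ c i := mul_le_of_le_one_right (Nat.cast_nonneg _)
                (Real.log_two_lt_d9.le.trans (by norm_num))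
      _ = _ := by simp [hF]
  simp_rw [sqDist_singleton]
  rw [Finset.sum_comm, Finset.mul_sum]
  refine (Finset.sum_le_sum hx).trans (le_of_eq ?_)
  rw [Finset.sum_const, nsmul_eq_mul]
  calc _ = F * 2 * c i * (((others o i).card : ℝ) * 2 ^ s i) := by ring
    _ = _ := by rw [card_others_mul]; ring

variable (L P) in
/-- The number of choices in the face of `S` on which `P` answers `b`. -/
def answerCount (S : Finset (Fin k)) (b : Bool) : ℕ :=
  ((face o S).filter fun x => P.result (L.input x) = b).card

variable (L P) in
theorem answerCount_add (S : Finset (Fin k)) :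
    (L.answerCount P S false : ℝ) + L.answerCount P S true = faceCard s := by
  rw [← card_face (o := o) S]
  exact card_filter_add_card_filter _ _

variable (L P) in
/-- The answer can tell the two promise cases apart only if the transcript distributions are far
from each other. -/
theorem sq_answerCount_sub_le :
    ((L.answerCount P univ true : ℝ) - L.answerCount P ∅ true) ^ 2 ≤
      4 * faceCard s * sqDist P.transcripts (fun S t => √(L.law P S t : ℝ)) univ := by
  classical
  -- The accepting transcripts.
  let acc := P.transcripts.filter fun t => ∃ X, P.transcript X = t ∧ P.result X = true
  have hacc : ∀ S, (L.answerCount P S true : ℝ) = ∑ t ∈ acc, (L.law P S t : ℝ) := by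
    intro S
    have hmaps : ∀ x ∈ (face o S).filter fun x => P.result (L.input x) = true,
        P.transcript (L.input x) ∈ acc := fun x hx =>
      Finset.mem_filter.2 ⟨P.transcript_mem_transcripts _, _, rfl, (Finset.mem_filter.1 hx).2⟩
    rw [answerCount, Finset.card_eq_sum_card_fiberwise hmaps, Nat.cast_sum]
    refine Finset.sum_congr rfl fun t ht => ?_
    obtain ⟨-, X, hX, hres⟩ := Finset.mem_filter.1 ht
    rw [law, Finset.filter_filter]
    congr 2
    ext x
    simp only [Finset.mem_filter, and_congr_right_iff, and_iff_right_iff_imp]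
    intro _ hx
    rw [← hres]
    exact P.result_eq_of_transcript_eq (hx.trans hX.symm)
  set a : List (Fin k × Bool) → ℝ := fun t => √(L.law P ∅ t : ℝ)
  set b : List (Fin k × Bool) → ℝ := fun t => √(L.law P univ t : ℝ)
  have ha : ∀ t, (L.law P ∅ t : ℝ) = a t ^ 2 := fun t => (Real.sq_sqrt (Nat.cast_nonneg _)).symm
  have hb : ∀ t, (L.law P univ t : ℝ) = b t ^ 2 := fun t =>
    (Real.sq_sqrt (Nat.cast_nonneg _)).symm
  rw [hacc, hacc, ← Finset.sum_sub_distrib]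
  calc (∑ t ∈ acc, ((L.law P univ t : ℝ) - L.law P ∅ t)) ^ 2
      = (∑ t ∈ acc, (a t - b t) * (a t + b t)) ^ 2 := by
        rw [← neg_sq, ← Finset.sum_neg_distrib]
        congr 1
        exact Finset.sum_congr rfl fun t _ => by rw [ha, hb]; ring
    _ ≤ (∑ t ∈ acc, (a t - b t) ^ 2) * ∑ t ∈ acc, (a t + b t) ^ 2 :=
        Finset.sum_mul_sq_le_sq_mul_sq _ _ _
    _ ≤ (∑ t ∈ P.transcripts, (a t - b t) ^ 2) * ∑ t ∈ P.transcripts, (a t + b t) ^ 2 := by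
        gcongr <;> exact Finset.filter_subset _ _
    _ ≤ (∑ t ∈ P.transcripts, (a t - b t) ^ 2) *
          ∑ t ∈ P.transcripts, (2 * (L.law P ∅ t : ℝ) + 2 * (L.law P univ t : ℝ)) := by
        gcongr with t
        rw [ha, hb]
        nlinarith [sq_nonneg (a t - b t)]
    _ = _ := by
        rw [Finset.sum_add_distrib, ← Finset.mul_sum, ← Finset.mul_sum, sum_law, sum_law, sqDist]
        ring

variable (L) in
theorem sum_answerCount (P : Protocol k n) {S : Finset (Fin k)} {b : Bool}
    (hS : ∀ i, decide (i ∈ S) = b) :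
    ∑ σ : Equiv.Perm (Fin n), ((L.perm σ).answerCount P S b : ℝ) =
      Fintype.card (Equiv.Perm (Fin n)) * (faceCard s * P.successOn s b) := by
  have hF : (Fintype.card (Equiv.Perm (Fin n)) : ℝ) ≠ 0 := Nat.cast_ne_zero.2 Fintype.card_ne_zero
  have h : ∀ x ∈ face o S, ∑ σ : Equiv.Perm (Fin n),
      (if P.result ((L.perm σ).input x) = b then (1 : ℝ) else 0) =
        Fintype.card (Equiv.Perm (Fin n)) * P.successOn s b := by
    intro x hx
    rw [mem_face] at hx
    rw [successOn_eq_average (L.input_mem_sizedInputs fun i => (hx i).trans (hS i)) P]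
    simp only [input_perm]
    field_simp
  calc _ = ∑ σ : Equiv.Perm (Fin n), ∑ x ∈ face o S,
        (if P.result ((L.perm σ).input x) = b then (1 : ℝ) else 0) := by
        refine Finset.sum_congr rfl fun σ _ => ?_
        rw [Finset.sum_boole]; rfl
    _ = _ := by
        rw [Finset.sum_comm, Finset.sum_congr rfl h, Finset.sum_const, nsmul_eq_mul, card_face]
        ring

end Layout

/-! ### The lower bound -/

/-- The lower bound for deterministic protocols and uniform inputs, for every error `δ < 1 / 2`. -/
theorem le_sum_div_of_solvesUniform {s c : Fin k → ℕ} {δ : ℝ} (hδ : δ < 1 / 2) (hk : 0 < k)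
    (hs : ∀ i, 1 ≤ s i) (hn : 2 * ∑ i, s i ≤ n) {P : Protocol k n} (hP : P.Bounded c)
    (h : P.SolvesUniform s δ) :
    (1 - 2 * δ) ^ 2 / 64 ≤ ∑ i, (c i : ℝ) / (s i : ℝ) := by
  obtain ⟨L⟩ := Layout.exists_layout (o := fun i => ⟨0, hs i⟩) hk hn
  set F : ℝ := (Fintype.card (Equiv.Perm (Fin n)) : ℝ) with hF
  have hF0 : 0 < F := Nat.cast_pos.2 Fintype.card_pos
  set M := Layout.faceCard s with hM
  have hM0 : 0 < M := Layout.faceCard_pos s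
  set D : Equiv.Perm (Fin n) → ℝ := fun σ =>
    ((L.perm σ).answerCount P univ true : ℝ) - (L.perm σ).answerCount P ∅ true with hD
  set H : Finset (Fin k) → Equiv.Perm (Fin n) → ℝ := fun S σ =>
    sqDist P.transcripts (fun S t => √((L.perm σ).law P S t : ℝ)) S with hH
  have hadv : F * M * (1 - 2 * δ) ≤ ∑ σ, D σ := by
    have h1 : ∀ σ, D σ = (L.perm σ).answerCount P univ true +
        (L.perm σ).answerCount P ∅ false - M := fun σ => by
      rw [hM, ← (L.perm σ).answerCount_add P ∅]; simp only [hD]; ring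
    simp_rw [h1]
    rw [Finset.sum_sub_distrib, Finset.sum_add_distrib, L.sum_answerCount P (by simp),
      L.sum_answerCount P (by simp), Finset.sum_const, Finset.card_univ, nsmul_eq_mul, ← hF, ← hM]
    unfold Protocol.SolvesUniform at h
    have hFM : 0 < F * M := by positivity
    nlinarith
  have hsingle : ∀ i, ∑ σ, H {i} σ ≤ 4 * F * M * ((c i : ℝ) / s i) := by
    intro i
    have hsi : (0 : ℝ) < s i := by exact_mod_cast hs i
    have := L.mul_sum_sqDist_singleton_le hP i
    rw [mul_div_assoc', le_div_iff₀ hsi]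
    linarith
  have huniv : ∑ σ, H univ σ ≤ 16 * F * M * ∑ i, (c i : ℝ) / s i := by
    calc ∑ σ, H univ σ ≤ ∑ σ, 4 * ∑ i, H {i} σ :=
          Finset.sum_le_sum fun σ _ => ((L.perm σ).law_cutPaste P ⟨0, hk⟩).sqDist_univ_le
      _ = 4 * ∑ i, ∑ σ, H {i} σ := by rw [← Finset.mul_sum, Finset.sum_comm]
      _ ≤ 4 * ∑ i, 4 * F * M * ((c i : ℝ) / s i) := by
          gcongr with i; exact hsingle i
      _ = _ := by rw [← Finset.mul_sum]; ring
  have hsq : (∑ σ, D σ) ^ 2 ≤ F * (4 * M * ∑ σ, H univ σ) := by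
    calc (∑ σ, D σ) ^ 2 ≤ F * ∑ σ, D σ ^ 2 := by
          simpa [hF] using sq_sum_le_card_mul_sum_sq (s := univ) (f := D)
      _ ≤ F * ∑ σ, 4 * M * H univ σ := by
          gcongr with σ; exact (L.perm σ).sq_answerCount_sub_le P
      _ = _ := by rw [← Finset.mul_sum]
  have hfin : (F * M) ^ 2 * (1 - 2 * δ) ^ 2 ≤
      (F * M) ^ 2 * (64 * ∑ i, (c i : ℝ) / s i) := by
    calc (F * M) ^ 2 * (1 - 2 * δ) ^ 2 = (F * M * (1 - 2 * δ)) ^ 2 := by ring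
      _ ≤ (∑ σ, D σ) ^ 2 := by
          refine pow_le_pow_left₀ ?_ hadv 2
          have : 0 < 1 - 2 * δ := by linarith
          positivity
      _ ≤ F * (4 * M * (16 * F * M * ∑ i, (c i : ℝ) / s i)) := hsq.trans (by gcongr)
      _ = _ := by ring
  have := le_of_mul_le_mul_left hfin (by positivity)
  linarith

end UDisj

theorem theorem1p4 :
    -- randomized protocols, worst-case inputs, any constant error below `1/2`
    (∀ δ : ℝ, δ < 1 / 2 → ∃ C : ℝ, 0 < C ∧
      ∀ (k n : ℕ) (s c : Fin k → ℕ), 2 ≤ k → (∀ i, 1 ≤ s i) → 2 * ∑ i, s i ≤ n →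
        ∀ R : UDisj.RandProtocol k n, R.Bounded c → R.Solves s δ →
          C ≤ ∑ i, (c i : ℝ) / (s i : ℝ)) ∧
    -- deterministic protocols, uniform inputs of fixed sizes, error `1%`
    (∃ C : ℝ, 0 < C ∧
      ∀ (k n : ℕ) (s c : Fin k → ℕ), 2 ≤ k → (∀ i, 1 ≤ s i) → 2 * ∑ i, s i ≤ n →
        ∀ P : UDisj.Protocol k n, P.Bounded c → P.SolvesUniform s (1 / 100) →
          C ≤ ∑ i, (c i : ℝ) / (s i : ℝ)) ∧
    -- equivalence of the two settings, with the same communication bounds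
    (∀ (k n : ℕ) (s c : Fin k → ℕ) (δ : ℝ), 2 ≤ k → (∀ i, 1 ≤ s i) → ∑ i, s i ≤ n →
      ((∃ R : UDisj.RandProtocol k n, R.Bounded c ∧ R.Solves s δ) →
        ∃ P : UDisj.Protocol k n, P.Bounded c ∧ P.SolvesUniform s δ) ∧
      ((∃ P : UDisj.Protocol k n, P.Bounded c ∧ P.SolvesUniform s δ) →
        ∃ R : UDisj.RandProtocol k n, R.Bounded c ∧ R.Solves s (2 * δ))) := by
  refine ⟨fun δ hδ => ⟨(1 - 2 * δ) ^ 2 / 64, ?_, ?_⟩,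
    ⟨(1 - 2 * (1 / 100)) ^ 2 / 64, by norm_num, ?_⟩, ?_⟩
  · have : 0 < 1 - 2 * δ := by linarith
    positivity
  · intro k n s c hk hs hn R hR h
    obtain ⟨P, hP, hPs⟩ := UDisj.exists_solvesUniform_of_rand
      (UDisj.sizedInputs_nonempty (by omega) hs (by omega)) hR h
    exact UDisj.le_sum_div_of_solvesUniform hδ (by omega) hs hn hP hPs
  · intro k n s c hk hs hn P hP h
    exact UDisj.le_sum_div_of_solvesUniform (by norm_num) (by omega) hs hn hP h
  · intro k n s c δ hk hs hn
    refine ⟨?_, ?_⟩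
    · rintro ⟨R, hR, h⟩
      exact UDisj.exists_solvesUniform_of_rand
        (UDisj.sizedInputs_nonempty (by omega) hs hn) hR h
    · rintro ⟨P, hP, h⟩
      exact UDisj.exists_rand_of_solvesUniform hP h
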